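/- All objects are over $\mathbb{C}$. Let $r\ge n\ge 1$ be integers, let $A\in \mathrm{M}(r,r;\mathbb{C})$ be an invertible matrix (not necessarily symmetric), $D=(d_{ij})\in \mathrm{M}(r,n;\mathbb{C})$ an arbitrary matrix, and $\Gamma=\mathrm{diag}(\gamma_1,\dots,\gamma_n)$ an invertible diagonal matrix. Let $\mathfrak{h}^r=\mathfrak{gl}_1^r=\mathbb{C}^r$ be the commutative Lie algebra with standard basis $\epsilon_1,\dots,\epsilon_r$ and bilinear form $B_A(c,c')=c\cdot{}^tA^{-1}\cdot{}^tc'$ ($c,c'$ row vectors). Let $\mathbb{C}_D=\bigoplus_{j=1}^n\mathbb{C}e_j$ and $\mathbb{C}_{-D}=\bigoplus_{j=1}^n\mathbb{C}f_j$ be the $\mathfrak{h}^r$-modules with $\epsilon_i e_j=d_{ij}e_j$ and $\epsilon_i f_j=-d_{ij}f_j$, paired by $\langle e_i,f_j\rangle=\delta_{ij}\gamma_i$. These data form the pentad of Cartan type $P(r,n;A,D,\Gamma)$. It is a standard pentad: there is a unique bilinear map $\Phi:\mathbb{C}_D\times\mathbb{C}_{-D}\to\mathfrak{h}^r$ with $B_A(a,\Phi(v,\phi))=\langle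 a v,\phi\rangle$ for all $a\in\mathfrak{h}^r$, $v\in\mathbb{C}_D$, $\phi\in\mathbb{C}_{-D}$. Let $L(r,n;A,D,\Gamma)=\bigoplus_{i\in\mathbb{Z}}V_i$ be the Lie algebra associated with this pentad, that is, the (unique up to isomorphism) $\mathbb{Z}$-graded Lie algebra generated by $V_{-1}\oplus V_0\oplus V_1$ such that $V_{-1}=\mathbb{C}_{-D}$, $V_0=\mathfrak{h}^r$, $V_1=\mathbb{C}_D$ with $[a,v]=av$, $[a,\phi]=a\phi$, $[v,\phi]=\Phi(v,\phi)$ for $a\in V_0$, $v\in V_1$, $\phi\in V_{-1}$, and such that for every $i\ge 2$ an element $x\in V_i$ with $[x,V_{-1}]=0$ is zero and an element $x\in V_{-i}$ with $[x,V_1]=0$ is zero. For $C=(C_{ij})\in \mathrm{M}(n,n;\mathbb{C})$ let $G(C)$ be Kac's contragredient Lie algebra with Cartan matrix $C$, that is, the minimal graded Lie algebra $\bigoplus_{i\in\mathbb{Z}} G_i$ (generated by $G_{-1}\oplus G_0\oplus G_1$, and without non-zero graded ideals meeting $G_{-1}\oplus G_0\oplus G_1$ trivially) for which $G_{-1},G_0,G_1$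 have bases $\{f_i\},\{h_i\},\{e_i\}$ $(1\le i\le n)$ with $[e_i,f_j]=\delta_{ij}h_i$, $[h_i,h_j]=0$, $[h_i,e_j]=C_{ij}e_j$, $[h_i,f_j]=-C_{ij}f_j$. Theorem. Assume that the pentad is regular, i.e. that its Cartan matrix $C(A,D,\Gamma)=\Gamma\cdot{}^tD\cdot A\cdot D$ is invertible. Then $L(r,n;A,D,\Gamma)$ is the direct sum of its center, which is $(r-n)$-dimensional, and of a contragredient Lie algebra with Cartan matrix $C(A,D,\Gamma)$: there is an isomorphism of Lie algebras $$L(r,n;A,D,\Gamma)\simeq \mathfrak{gl}_1^{\,r-n}\oplus G(C(A,D,\Gamma))$$ under which the center of $L(r,n;A,D,\Gamma)$ corresponds to $\mathfrak{gl}_1^{\,r-n}$. In particular, if $r=n$, then $L(r,r;A,D,\Gamma)\simeq G(C(A,D,\Gamma))$. -/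

import Mathlib

open scoped Matrix

noncomputable section

/-! ## Local Lie algebras and the graded Lie algebras they determine -/

/-- A (complex) local Lie algebra `G₋₁ ⊕ G₀ ⊕ G₁`: a Lie algebra `G₀`, two `G₀`-modules
`G₁` and `G₋₁`, and a `G₀`-equivariant bilinear bracket `G₁ × G₋₁ → G₀`. -/
structure LocalLieAlgebra (G₀ G₁ Gm : Type*)
    [LieRing G₀] [LieAlgebra ℂ G₀]
    [AddCommGroup G₁] [Module ℂ G₁] [LieRingModule G₀ G₁] [LieModule ℂ G₀ G₁]
    [AddCommGroup Gm] [Module ℂ Gm] [LieRingModule G₀ Gm] [LieModule ℂ G₀ Gm] where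
  /-- The bracket `[x, y] ∈ G₀` of `x ∈ G₁` and `y ∈ G₋₁`. -/
  bracket : G₁ →ₗ[ℂ] Gm →ₗ[ℂ] G₀
  lie_bracket : ∀ (a : G₀) (x : G₁) (y : Gm),
    ⁅a, bracket x y⁆ = bracket ⁅a, x⁆ y + bracket x ⁅a, y⁆

namespace LocalLieAlgebra

section

variable {G₀ G₁ Gm : Type*}
    [LieRing G₀] [LieAlgebra ℂ G₀]
    [AddCommGroup G₁] [Module ℂ G₁] [LieRingModule G₀ G₁] [LieModule ℂ G₀ G₁]
    [AddCommGroup Gm] [Module ℂ Gm] [LieRingModule G₀ Gm] [LieModule ℂ G₀ Gm]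

/-- The free Lie algebra on the set `G₁ ⊔ G₀ ⊔ G₋₁`. -/
abbrev Free (_X : LocalLieAlgebra G₀ G₁ Gm) : Type _ :=
  FreeLieAlgebra ℂ (G₁ ⊕ G₀ ⊕ Gm)

/-- The free generator attached to an element of `G₁`. -/
def freePos (X : LocalLieAlgebra G₀ G₁ Gm) (x : G₁) : X.Free :=
  FreeLieAlgebra.of ℂ (Sum.inl x)

/-- The free generator attached to an element of `G₀`. -/
def freeZero (X : LocalLieAlgebra G₀ G₁ Gm) (a : G₀) : X.Free :=
  FreeLieAlgebra.of ℂ (Sum.inr (Sum.inl a))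

/-- The free generator attached to an element of `G₋₁`. -/
def freeNeg (X : LocalLieAlgebra G₀ G₁ Gm) (y : Gm) : X.Free :=
  FreeLieAlgebra.of ℂ (Sum.inr (Sum.inr y))

/-- The elements of the free Lie algebra on the set `G₁ ⊔ G₀ ⊔ G₋₁` which express that the
three inclusions are linear and that the brackets of `G₀` with `G₀`, of `G₀` with `G₁`, of `G₀`
with `G₋₁` and of `G₁` with `G₋₁` are those of the local Lie algebra. -/
inductive Relator (X : LocalLieAlgebra G₀ G₁ Gm) : X.Free → Prop
  | add_pos (x x' : G₁) : Relator X (X.freePos (x + x') - (X.freePos x + X.freePos x'))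
  | smul_pos (c : ℂ) (x : G₁) : Relator X (X.freePos (c • x) - c • X.freePos x)
  | add_zero (a a' : G₀) : Relator X (X.freeZero (a + a') - (X.freeZero a + X.freeZero a'))
  | smul_zero (c : ℂ) (a : G₀) : Relator X (X.freeZero (c • a) - c • X.freeZero a)
  | add_neg (y y' : Gm) : Relator X (X.freeNeg (y + y') - (X.freeNeg y + X.freeNeg y'))
  | smul_neg (c : ℂ) (y : Gm) : Relator X (X.freeNeg (c • y) - c • X.freeNeg y)
  | lie_zero_zero (a b : G₀) : Relator X (X.freeZero ⁅a, b⁆ - ⁅X.freeZero a, X.freeZero b⁆)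
  | lie_zero_pos (a : G₀) (x : G₁) : Relator X (X.freePos ⁅a, x⁆ - ⁅X.freeZero a, X.freePos x⁆)
  | lie_zero_neg (a : G₀) (y : Gm) : Relator X (X.freeNeg ⁅a, y⁆ - ⁅X.freeZero a, X.freeNeg y⁆)
  | lie_pos_neg (x : G₁) (y : Gm) : Relator X
      (X.freeZero (X.bracket x y) - ⁅X.freePos x, X.freeNeg y⁆)

/-- The ideal of the free Lie algebra generated by the relators. -/
def relationIdeal (X : LocalLieAlgebra G₀ G₁ Gm) :
    LieIdeal ℂ X.Free :=
  LieSubmodule.lieSpan ℂ _ {z | X.Relator z}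

/-- The maximal graded Lie algebra with local part `X`: the Lie algebra generated by
`G₋₁ ⊕ G₀ ⊕ G₁` subject to nothing but the brackets of the local Lie algebra. -/
abbrev Maximal (X : LocalLieAlgebra G₀ G₁ Gm) : Type _ :=
  X.Free ⧸ X.relationIdeal

/-- The canonical map `G₁ → Maximal X`. -/
def pos (X : LocalLieAlgebra G₀ G₁ Gm) (x : G₁) : X.Maximal :=
  LieSubmodule.Quotient.mk (X.freePos x)

/-- The canonical map `G₀ → Maximal X`. -/
def zero (X : LocalLieAlgebra G₀ G₁ Gm) (a : G₀) : X.Maximal :=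
  LieSubmodule.Quotient.mk (X.freeZero a)

/-- The canonical map `G₋₁ → Maximal X`. -/
def neg (X : LocalLieAlgebra G₀ G₁ Gm) (y : Gm) : X.Maximal :=
  LieSubmodule.Quotient.mk (X.freeNeg y)

/-- Iterated brackets of elements of `G₁`, `G₀`, `G₋₁`, with their degree. -/
inductive IsMonomial (X : LocalLieAlgebra G₀ G₁ Gm) : ℤ → X.Maximal → Prop
  | pos (x : G₁) : IsMonomial X 1 (X.pos x)
  | zero (a : G₀) : IsMonomial X 0 (X.zero a)
  | neg (y : Gm) : IsMonomial X (-1) (X.neg y)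
  | lie {i j : ℤ} {u v : X.Maximal} :
      IsMonomial X i u → IsMonomial X j v → IsMonomial X (i + j) ⁅u, v⁆

/-- The homogeneous component of degree `i` of the maximal graded Lie algebra. -/
def component (X : LocalLieAlgebra G₀ G₁ Gm) (i : ℤ) : Submodule ℂ X.Maximal :=
  Submodule.span ℂ {u | X.IsMonomial i u}

/-- A graded ideal of the maximal graded Lie algebra: one that is the sum of its intersections
with the homogeneous components. -/
def IsGradedIdeal (X : LocalLieAlgebra G₀ G₁ Gm) (I : LieIdeal ℂ X.Maximal) : Prop :=
  I.toSubmodule ≤ ⨆ i : ℤ, I.toSubmodule ⊓ X.component i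

/-- The largest graded ideal of the maximal graded Lie algebra which meets the local part
`G₋₁ ⊕ G₀ ⊕ G₁` trivially. -/
def minimalIdeal (X : LocalLieAlgebra G₀ G₁ Gm) : LieIdeal ℂ X.Maximal :=
  sSup {I | X.IsGradedIdeal I ∧
    I.toSubmodule ⊓ (X.component (-1) ⊔ X.component 0 ⊔ X.component 1) = ⊥}

/-- The minimal graded Lie algebra with local part `X`. -/
abbrev Minimal (X : LocalLieAlgebra G₀ G₁ Gm) : Type _ :=
  X.Maximal ⧸ X.minimalIdeal

/-- An ideal `I` of the maximal graded Lie algebra is transitive away from the local part if the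
quotient by `I` satisfies: an element of degree `i ≥ 2` that commutes with `G₋₁` is zero, and an
element of degree `i ≤ -2` that commutes with `G₁` is zero. -/
def IsTransitiveIdeal (X : LocalLieAlgebra G₀ G₁ Gm) (I : LieIdeal ℂ X.Maximal) : Prop :=
  (∀ i : ℤ, 2 ≤ i → ∀ u ∈ X.component i, (∀ y : Gm, ⁅u, X.neg y⁆ ∈ I) → u ∈ I) ∧
  (∀ i : ℤ, i ≤ -2 → ∀ u ∈ X.component i, (∀ x : G₁, ⁅u, X.pos x⁆ ∈ I) → u ∈ I)

/-- The smallest ideal of the maximal graded Lie algebra that is transitive away from the local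
part (this condition is stable under intersections). -/
def transitiveIdeal (X : LocalLieAlgebra G₀ G₁ Gm) : LieIdeal ℂ X.Maximal :=
  sInf {I | X.IsTransitiveIdeal I}

end

end LocalLieAlgebra

/-! ## Standard pentads and their Lie algebras -/

/-- A pentad `(𝔤, ρ, V, 𝒱, B₀)`: a Lie algebra with a non-degenerate invariant bilinear form
(not necessarily symmetric), a `𝔤`-module `V` and a `𝔤`-module `𝒱` which is paired invariantly
with `V`.  (When the pairing is non-degenerate, as it is for standard pentads, it identifies `𝒱`
with a submodule of `Hom(V, ℂ)`.) -/
structure Pentad (𝔤 V W : Type*)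
    [LieRing 𝔤] [LieAlgebra ℂ 𝔤]
    [AddCommGroup V] [Module ℂ V] [LieRingModule 𝔤 V] [LieModule ℂ 𝔤 V]
    [AddCommGroup W] [Module ℂ W] [LieRingModule 𝔤 W] [LieModule ℂ 𝔤 W] where
  /-- The pairing of `V` and `𝒱`. -/
  pairing : V →ₗ[ℂ] W →ₗ[ℂ] ℂ
  pairing_lie : ∀ (a : 𝔤) (v : V) (φ : W), pairing ⁅a, v⁆ φ = -pairing v ⁅a, φ⁆
  /-- The bilinear form `B₀`. -/
  form : 𝔤 →ₗ[ℂ] 𝔤 →ₗ[ℂ] ℂ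
  form_nondegenerate : form.Nondegenerate
  form_invariant : ∀ a b c : 𝔤, form ⁅a, b⁆ c = form a ⁅b, c⁆

namespace Pentad

section

variable {𝔤 V W : Type*}
    [LieRing 𝔤] [LieAlgebra ℂ 𝔤]
    [AddCommGroup V] [Module ℂ V] [LieRingModule 𝔤 V] [LieModule ℂ 𝔤 V]
    [AddCommGroup W] [Module ℂ W] [LieRingModule 𝔤 W] [LieModule ℂ 𝔤 W]

/-- `Φ : V ⊗ 𝒱 → 𝔤` is a `Φ`-map of the pentad if `B₀(a, Φ(v ⊗ φ)) = ⟨ρ(a ⊗ v), φ⟩`. -/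
def IsPhiMap (P : Pentad 𝔤 V W) (Φ : V →ₗ[ℂ] W →ₗ[ℂ] 𝔤) : Prop :=
  ∀ (a : 𝔤) (v : V) (φ : W), P.form a (Φ v φ) = P.pairing ⁅a, v⁆ φ

/-- Standard pentads: the pairing is non-degenerate and there is a `Φ`-map. -/
def IsStandard (P : Pentad 𝔤 V W) : Prop :=
  P.pairing.Nondegenerate ∧ ∃ Φ : V →ₗ[ℂ] W →ₗ[ℂ] 𝔤, P.IsPhiMap Φ

/-- The `Φ`-map of a standard pentad; it is unique as `B₀` is non-degenerate. -/
def phi (P : Pentad 𝔤 V W) (hP : P.IsStandard) : V →ₗ[ℂ] W →ₗ[ℂ] 𝔤 :=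
  hP.2.choose

theorem isPhiMap_phi (P : Pentad 𝔤 V W) (hP : P.IsStandard) : P.IsPhiMap (P.phi hP) :=
  hP.2.choose_spec

theorem IsPhiMap.unique {P : Pentad 𝔤 V W} {Φ Ψ : V →ₗ[ℂ] W →ₗ[ℂ] 𝔤}
    (hΦ : P.IsPhiMap Φ) (hΨ : P.IsPhiMap Ψ) : Φ = Ψ := by
  ext v φ
  rw [← sub_eq_zero]
  refine P.form_nondegenerate.2 _ fun a => ?_
  rw [map_sub, hΦ, hΨ, sub_self]

/-- The local Lie algebra `𝒱 ⊕ 𝔤 ⊕ V` of a standard pentad, with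
`[a, v] = ρ(a ⊗ v)`, `[a, φ] = ϱ(a ⊗ φ)` and `[v, φ] = Φ(v ⊗ φ)`. -/
def localPart (P : Pentad 𝔤 V W) (hP : P.IsStandard) : LocalLieAlgebra 𝔤 V W where
  bracket := P.phi hP
  lie_bracket a v φ := by
    have h := P.isPhiMap_phi hP
    rw [← sub_eq_zero]
    refine P.form_nondegenerate.2 _ fun b => ?_
    rw [map_sub, map_add, ← P.form_invariant, h, h, h, lie_lie, map_sub, LinearMap.sub_apply,
      P.pairing_lie a ⁅b, v⁆]
    ring

/-- The Lie algebra `L(𝔤, ρ, V, 𝒱, B₀) = ⨁ Vᵢ` associated with a standard pentad: the graded Lie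
algebra generated by its local part `V₋₁ ⊕ V₀ ⊕ V₁ = 𝒱 ⊕ 𝔤 ⊕ V` in which, for `i ≥ 2`, an element
of `Vᵢ` that commutes with `V₋₁` is zero and an element of `V₋ᵢ` that commutes with `V₁` is
zero. -/
abbrev AssociatedLieAlgebra (P : Pentad 𝔤 V W) (hP : P.IsStandard) : Type _ :=
  (P.localPart hP).Maximal ⧸ (P.localPart hP).transitiveIdeal

end

end Pentad

/-! ## Pentads of Cartan type -/

/-- The commutative Lie algebra `𝔥ʳ = 𝔤𝔩₁ʳ = ℂʳ`. -/
def Torus (r : ℕ) : Type := Fin r → ℂ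

namespace Torus

instance (r : ℕ) : AddCommGroup (Torus r) := inferInstanceAs (AddCommGroup (Fin r → ℂ))

instance (r : ℕ) : Module ℂ (Torus r) := inferInstanceAs (Module ℂ (Fin r → ℂ))

instance (r : ℕ) : LieRing (Torus r) where
  bracket _ _ := 0
  add_lie _ _ _ := (add_zero 0).symm
  lie_add _ _ _ := (add_zero 0).symm
  lie_self _ := rfl
  leibniz_lie _ _ _ := (add_zero 0).symm

theorem lie_eq_zero {r : ℕ} (a b : Torus r) : ⁅a, b⁆ = 0 := rfl

instance (r : ℕ) : LieAlgebra ℂ (Torus r) where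
  lie_smul c a b := by simp [lie_eq_zero]

end Torus

/-- The `𝔥ʳ`-module `ℂ_D = ℂⁿ`, on which `ε_i e_j = d_{ij} e_j`. -/
def WeightModule {r n : ℕ} (_D : Matrix (Fin r) (Fin n) ℂ) : Type := Fin n → ℂ

namespace WeightModule

variable {r n : ℕ} (D : Matrix (Fin r) (Fin n) ℂ)

instance : AddCommGroup (WeightModule D) := inferInstanceAs (AddCommGroup (Fin n → ℂ))

instance : Module ℂ (WeightModule D) := inferInstanceAs (Module ℂ (Fin n → ℂ))

instance : LieRingModule (Torus r) (WeightModule D) where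
  bracket a v := fun j => (∑ i, a i * D i j) * v j
  add_lie a b v := by
    funext j
    change (∑ i, (a i + b i) * D i j) * v j = _ * v j + _ * v j
    simp only [add_mul, Finset.sum_add_distrib]
  lie_add a v w := by
    funext j
    change _ * (v j + w j) = _ * v j + _ * w j
    ring
  leibniz_lie a b v := by
    funext j
    change _ * (_ * v j) = (∑ i, (0 : ℂ) * D i j) * v j + _ * (_ * v j)
    simp only [zero_mul, Finset.sum_const_zero]
    ring

theorem lie_apply (a : Torus r) (v : WeightModule D) (j : Fin n) :
    (⁅a, v⁆ : WeightModule D) j = (∑ i, a i * D i j) * v j := rfl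

instance : LieModule ℂ (Torus r) (WeightModule D) where
  smul_lie c a v := by
    funext j
    change (∑ i, (c * a i) * D i j) * v j = c * ((∑ i, a i * D i j) * v j)
    simp only [mul_assoc, ← Finset.mul_sum]
  lie_smul c a v := by
    funext j
    change _ * (c * v j) = c * (_ * v j)
    ring

end WeightModule

/-- The data of a pentad of Cartan type `P(r, n; A, D, Γ)`: an invertible `r × r` matrix `A`, an
arbitrary `r × n` matrix `D` and an invertible diagonal `n × n` matrix `Γ`. -/
structure CartanPentad (r n : ℕ) where
  A : Matrix (Fin r) (Fin r) ℂ
  D : Matrix (Fin r) (Fin n) ℂ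
  Γ : Matrix (Fin n) (Fin n) ℂ
  isUnit_A : IsUnit A
  isDiag_Γ : Γ.IsDiag
  isUnit_Γ : IsUnit Γ

namespace CartanPentad

variable {r n : ℕ}

/-- The pairing `⟨e_i, f_j⟩ = δ_{ij} γ_i` of `ℂ_D` and `ℂ_{-D}`. -/
def pairing (P : CartanPentad r n) :
    WeightModule P.D →ₗ[ℂ] WeightModule (-P.D) →ₗ[ℂ] ℂ :=
  LinearMap.mk₂ ℂ (fun v φ => ∑ j, P.Γ j j * (v j * φ j))
    (fun v w φ => by
      change ∑ j, P.Γ j j * ((v j + w j) * φ j) = _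
      simp only [add_mul, mul_add, Finset.sum_add_distrib])
    (fun c v φ => by
      change ∑ j, P.Γ j j * ((c * v j) * φ j) = c * _
      rw [Finset.mul_sum]
      exact Finset.sum_congr rfl fun j _ => by ring)
    (fun v φ ψ => by
      change ∑ j, P.Γ j j * (v j * (φ j + ψ j)) = _
      simp only [mul_add, Finset.sum_add_distrib])
    (fun c v φ => by
      change ∑ j, P.Γ j j * (v j * (c * φ j)) = c * _
      rw [Finset.mul_sum]
      exact Finset.sum_congr rfl fun j _ => by ring)

theorem pairing_apply (P : CartanPentad r n) (v : WeightModule P.D) (φ : WeightModule (-P.D)) :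
    P.pairing v φ = ∑ j, P.Γ j j * (v j * φ j) := rfl

/-- The bilinear form `B_A(c, c') = c · ᵗA⁻¹ · ᵗc'` on `𝔥ʳ`. -/
def form (P : CartanPentad r n) : Torus r →ₗ[ℂ] Torus r →ₗ[ℂ] ℂ :=
  Matrix.toLinearMap₂' ℂ (P.Aᵀ)⁻¹

theorem form_apply (P : CartanPentad r n) (c c' : Torus r) :
    P.form c c' = (c : Fin r → ℂ) ⬝ᵥ ((P.Aᵀ)⁻¹ *ᵥ (c' : Fin r → ℂ)) :=
  Matrix.toLinearMap₂'_apply' _ _ _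

theorem Γ_ne_zero (P : CartanPentad r n) (j : Fin n) : P.Γ j j ≠ 0 := by
  have h := (Matrix.isUnit_iff_isUnit_det _).1 P.isUnit_Γ
  rw [← P.isDiag_Γ.diagonal_diag, Matrix.det_diagonal, isUnit_iff_ne_zero,
    Finset.prod_ne_zero_iff] at h
  exact h j (Finset.mem_univ j)

theorem form_nondegenerate (P : CartanPentad r n) : P.form.Nondegenerate := by
  have hu : IsUnit (P.Aᵀ)⁻¹ :=
    Matrix.isUnit_nonsing_inv_iff.2 ((Matrix.isUnit_transpose P.A).2 P.isUnit_A)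
  constructor
  · intro c hc
    have h : Matrix.vecMul (c : Fin r → ℂ) (P.Aᵀ)⁻¹ = 0 := by
      funext j
      have := (Matrix.dotProduct_mulVec (c : Fin r → ℂ) (P.Aᵀ)⁻¹ (Pi.single j 1)).symm.trans
        ((P.form_apply c (Pi.single j 1 : Fin r → ℂ)).symm.trans (hc _))
      simpa using this
    exact Matrix.vecMul_injective_of_isUnit hu (h.trans (Matrix.zero_vecMul _).symm)
  · intro c hc
    have h : (P.Aᵀ)⁻¹ *ᵥ (c : Fin r → ℂ) = 0 := by
      funext j
      have := (P.form_apply (Pi.single j 1 : Fin r → ℂ) c).symm.trans (hc _)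
      simpa using this
    exact Matrix.mulVec_injective_of_isUnit hu (h.trans (Matrix.mulVec_zero _).symm)

theorem pairing_nondegenerate (P : CartanPentad r n) : P.pairing.Nondegenerate := by
  constructor
  · intro v hv
    funext j
    have := (P.pairing_apply v (Pi.single j 1 : Fin n → ℂ)).symm.trans (hv _)
    rw [Finset.sum_eq_single j] at this
    · rw [Pi.single_eq_same, mul_one] at this
      exact (mul_eq_zero.1 this).resolve_left (P.Γ_ne_zero j)
    · intro k _ hk
      rw [Pi.single_eq_of_ne hk, mul_zero, mul_zero]
    · exact fun h => absurd (Finset.mem_univ j) h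
  · intro φ hφ
    funext j
    have := (P.pairing_apply (Pi.single j 1 : Fin n → ℂ) φ).symm.trans (hφ _)
    rw [Finset.sum_eq_single j] at this
    · rw [Pi.single_eq_same, one_mul] at this
      exact (mul_eq_zero.1 this).resolve_left (P.Γ_ne_zero j)
    · intro k _ hk
      rw [Pi.single_eq_of_ne hk, zero_mul, mul_zero]
    · exact fun h => absurd (Finset.mem_univ j) h

/-- The pentad of Cartan type `P(r, n; A, D, Γ) = (𝔥ʳ, □_D, ℂ_D, ℂ_{-D}, B_A)`. -/
def pentad (P : CartanPentad r n) :
    Pentad (Torus r) (WeightModule P.D) (WeightModule (-P.D)) where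
  pairing := P.pairing
  pairing_lie a v φ := by
    rw [pairing_apply, pairing_apply, ← Finset.sum_neg_distrib]
    refine Finset.sum_congr rfl fun j _ => ?_
    simp only [WeightModule.lie_apply, Matrix.neg_apply, mul_neg, Finset.sum_neg_distrib]
    ring
  form := P.form
  form_nondegenerate := P.form_nondegenerate
  form_invariant a b c := by
    simp only [Torus.lie_eq_zero, map_zero, LinearMap.zero_apply]

/-- The `Φ`-map of a pentad of Cartan type: `Φ(e_i ⊗ f_j) = δ_{ij} γ_i · ᵗA · (D e_i)`. -/
def cartanPhi (P : CartanPentad r n) :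
    WeightModule P.D →ₗ[ℂ] WeightModule (-P.D) →ₗ[ℂ] Torus r :=
  LinearMap.mk₂ ℂ
    (fun v φ => fun k => ∑ i, P.A i k * ∑ j, P.D i j * (P.Γ j j * (v j * φ j)))
    (fun v w φ => by
      funext k
      change ∑ i, P.A i k * ∑ j, P.D i j * (P.Γ j j * ((v j + w j) * φ j)) =
        (∑ i, P.A i k * ∑ j, P.D i j * (P.Γ j j * (v j * φ j))) +
          ∑ i, P.A i k * ∑ j, P.D i j * (P.Γ j j * (w j * φ j))
      simp only [add_mul, mul_add, Finset.sum_add_distrib])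
    (fun c v φ => by
      funext k
      change ∑ i, P.A i k * ∑ j, P.D i j * (P.Γ j j * ((c * v j) * φ j)) =
        c * ∑ i, P.A i k * ∑ j, P.D i j * (P.Γ j j * (v j * φ j))
      simp only [Finset.mul_sum]
      exact Finset.sum_congr rfl fun i _ => Finset.sum_congr rfl fun j _ => by ring)
    (fun v φ ψ => by
      funext k
      change ∑ i, P.A i k * ∑ j, P.D i j * (P.Γ j j * (v j * (φ j + ψ j))) =
        (∑ i, P.A i k * ∑ j, P.D i j * (P.Γ j j * (v j * φ j))) +
          ∑ i, P.A i k * ∑ j, P.D i j * (P.Γ j j * (v j * ψ j))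
      simp only [mul_add, Finset.sum_add_distrib])
    (fun c v φ => by
      funext k
      change ∑ i, P.A i k * ∑ j, P.D i j * (P.Γ j j * (v j * (c * φ j))) =
        c * ∑ i, P.A i k * ∑ j, P.D i j * (P.Γ j j * (v j * φ j))
      simp only [Finset.mul_sum]
      exact Finset.sum_congr rfl fun i _ => Finset.sum_congr rfl fun j _ => by ring)

theorem cartanPhi_eq (P : CartanPentad r n) (v : WeightModule P.D) (φ : WeightModule (-P.D)) :
    (P.cartanPhi v φ : Fin r → ℂ) =
      P.Aᵀ *ᵥ (P.D *ᵥ fun j => P.Γ j j * (v j * φ j)) := rfl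

theorem isPhiMap_cartanPhi (P : CartanPentad r n) : P.pentad.IsPhiMap P.cartanPhi := by
  intro a v φ
  have hd : IsUnit (P.Aᵀ).det :=
    (Matrix.isUnit_iff_isUnit_det _).1 ((Matrix.isUnit_transpose P.A).2 P.isUnit_A)
  refine (P.form_apply a (P.cartanPhi v φ)).trans (Eq.trans ?_ (P.pairing_apply ⁅a, v⁆ φ).symm)
  rw [cartanPhi_eq, Matrix.mulVec_mulVec, Matrix.nonsing_inv_mul _ hd, Matrix.one_mulVec]
  refine (Matrix.dotProduct_mulVec (a : Fin r → ℂ) P.D _).trans ?_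
  refine Finset.sum_congr rfl fun j _ => ?_
  rw [WeightModule.lie_apply]
  change (∑ i, a i * P.D i j) * _ = _
  ring

/-- A pentad of Cartan type is standard. -/
theorem isStandard (P : CartanPentad r n) : P.pentad.IsStandard :=
  ⟨P.pairing_nondegenerate, P.cartanPhi, P.isPhiMap_cartanPhi⟩

/-- The Cartan matrix `C(A, D, Γ) = Γ · ᵗD · A · D`. -/
def cartanMatrix (P : CartanPentad r n) : Matrix (Fin n) (Fin n) ℂ :=
  P.Γ * P.Dᵀ * P.A * P.D

/-- A pentad of Cartan type is regular if its Cartan matrix is invertible. -/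
def IsRegular (P : CartanPentad r n) : Prop :=
  IsUnit P.cartanMatrix

/-- The PC Lie algebra `L(r, n; A, D, Γ)`, associated with the pentad `P(r, n; A, D, Γ)`. -/
abbrev PCLieAlgebra (P : CartanPentad r n) : Type :=
  P.pentad.AssociatedLieAlgebra P.isStandard

end CartanPentad

/-! ## Contragredient Lie algebras -/

/-- The local Lie algebra `Ĝ(C) = ⟨f_i⟩ ⊕ ⟨h_i⟩ ⊕ ⟨e_i⟩` of a square matrix `C`:
`[e_i, f_j] = δ_{ij} h_i`, `[h_i, h_j] = 0`, `[h_i, e_j] = C_{ij} e_j`, `[h_i, f_j] = -C_{ij} f_j`;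
here `h_i`, `e_i`, `f_i` are the standard basis vectors of three copies of `ℂⁿ`. -/
def contragredientLocalPart {n : ℕ} (C : Matrix (Fin n) (Fin n) ℂ) :
    LocalLieAlgebra (Torus n) (WeightModule C) (WeightModule (-C)) where
  bracket := LinearMap.mk₂ ℂ (fun x y => (fun i => x i * y i : Fin n → ℂ))
    (fun x x' y => funext fun i => add_mul (x i) (x' i) (y i))
    (fun c x y => funext fun i => mul_assoc c (x i) (y i))
    (fun x y y' => funext fun i => mul_add (x i) (y i) (y' i))
    (fun c x y => funext fun i => mul_left_comm (x i) c (y i))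
  lie_bracket a x y := by
    funext i
    change 0 = (⁅a, x⁆ : WeightModule C) i * y i + x i * (⁅a, y⁆ : WeightModule (-C)) i
    simp only [WeightModule.lie_apply, Matrix.neg_apply, mul_neg, Finset.sum_neg_distrib]
    ring

/-- The contragredient Lie algebra `G(C)` with Cartan matrix `C`: the minimal graded Lie algebra
with local part `Ĝ(C)`. -/
abbrev ContragredientLieAlgebra {n : ℕ} (C : Matrix (Fin n) (Fin n) ℂ) : Type :=
  (contragredientLocalPart C).Minimal

end

/-!
A local Lie algebra `G₋₁ ⊕ G₀ ⊕ G₁` has an Euler element if some element of `G₀` acts on it by the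
degree. The Cartan matrix `C` being invertible, the contragredient local Lie algebra `Ĝ(C)` has
one, namely `ᵗC⁻¹ (1, …, 1)`. In the presence of an Euler element the components of the maximal
graded Lie algebra lie in different eigenspaces, hence are independent, and so the minimal ideal is
concentrated in the degrees `|i| ≥ 2`. Moreover the minimal ideal is transitive
(`IsEuler.isTransitiveIdeal_minimalIdeal`): if `u` has degree `≥ 2` and commutes with `G₋₁` modulo
this ideal, then the ideal generated by `u` together with it is graded and still misses the local
part.

For a regular pentad, the map `ᵗA D Γ : ℂⁿ → 𝔥ʳ` is split injective, as `ᵗA D Γ b` has the same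
weights on `ℂ_D` as `b` has on the degree `1` part of `Ĝ(C)`. So the local part of the pentad is
the sum of `Ĝ(C)` and of the common kernel of the weights, which is central of dimension `r - n`,
and the maximal graded Lie algebras decompose accordingly. By induction on the degree, a transitive
ideal contains every element of the minimal ideal of the contragredient side; as the latter is
itself transitive, it is the smallest transitive ideal (`IsEuler.transitiveIdeal_eq`). The
quotients give the isomorphism `IsRegular.nonempty_lieEquiv`.

The center of the Lie algebra of the pentad corresponds to `𝔤𝔩₁ʳ⁻ⁿ` because `G(C)` has no center
(`center_contragredientLieAlgebra`): the Euler element forces a central element into degree `0`,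
where a dimension count, using that `C` is invertible, shows that it vanishes.
-/

open scoped Matrix

noncomputable section

namespace LocalLieAlgebra

section

variable {G₀ G₁ Gm : Type*}
    [LieRing G₀] [LieAlgebra ℂ G₀]
    [AddCommGroup G₁] [Module ℂ G₁] [LieRingModule G₀ G₁] [LieModule ℂ G₀ G₁]
    [AddCommGroup Gm] [Module ℂ Gm] [LieRingModule G₀ Gm] [LieModule ℂ G₀ Gm]

/-! ### The universal property of the maximal graded Lie algebra -/

theorem mk_eq_of_relator (X : LocalLieAlgebra G₀ G₁ Gm) {u v : X.Free} (h : X.Relator (u - v)) :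
    (LieSubmodule.Quotient.mk u : X.Maximal) = LieSubmodule.Quotient.mk v :=
  (Submodule.Quotient.eq _).2 (LieSubmodule.subset_lieSpan h)

theorem lie_zero_zero (X : LocalLieAlgebra G₀ G₁ Gm) (a b : G₀) :
    ⁅X.zero a, X.zero b⁆ = X.zero ⁅a, b⁆ :=
  (X.mk_eq_of_relator (.lie_zero_zero a b)).symm

theorem lie_zero_pos (X : LocalLieAlgebra G₀ G₁ Gm) (a : G₀) (x : G₁) :
    ⁅X.zero a, X.pos x⁆ = X.pos ⁅a, x⁆ :=
  (X.mk_eq_of_relator (.lie_zero_pos a x)).symm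

theorem lie_zero_neg (X : LocalLieAlgebra G₀ G₁ Gm) (a : G₀) (y : Gm) :
    ⁅X.zero a, X.neg y⁆ = X.neg ⁅a, y⁆ :=
  (X.mk_eq_of_relator (.lie_zero_neg a y)).symm

theorem lie_pos_neg (X : LocalLieAlgebra G₀ G₁ Gm) (x : G₁) (y : Gm) :
    ⁅X.pos x, X.neg y⁆ = X.zero (X.bracket x y) :=
  (X.mk_eq_of_relator (.lie_pos_neg x y)).symm

/-- The canonical map `G₁ → Maximal X` as a linear map. -/
def posLinear (X : LocalLieAlgebra G₀ G₁ Gm) : G₁ →ₗ[ℂ] X.Maximal where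
  toFun := X.pos
  map_add' x x' := X.mk_eq_of_relator (.add_pos x x')
  map_smul' c x := X.mk_eq_of_relator (.smul_pos c x)

/-- The canonical map `G₀ → Maximal X` as a linear map. -/
def zeroLinear (X : LocalLieAlgebra G₀ G₁ Gm) : G₀ →ₗ[ℂ] X.Maximal where
  toFun := X.zero
  map_add' a a' := X.mk_eq_of_relator (.add_zero a a')
  map_smul' c a := X.mk_eq_of_relator (.smul_zero c a)

/-- The canonical map `G₋₁ → Maximal X` as a linear map. -/
def negLinear (X : LocalLieAlgebra G₀ G₁ Gm) : Gm →ₗ[ℂ] X.Maximal where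
  toFun := X.neg
  map_add' y y' := X.mk_eq_of_relator (.add_neg y y')
  map_smul' c y := X.mk_eq_of_relator (.smul_neg c y)

@[simp]
theorem posLinear_apply (X : LocalLieAlgebra G₀ G₁ Gm) (x : G₁) : X.posLinear x = X.pos x := rfl

@[simp]
theorem zeroLinear_apply (X : LocalLieAlgebra G₀ G₁ Gm) (a : G₀) : X.zeroLinear a = X.zero a := rfl

@[simp]
theorem negLinear_apply (X : LocalLieAlgebra G₀ G₁ Gm) (y : Gm) : X.negLinear y = X.neg y := rfl

/-- Lie algebra homomorphisms out of the maximal graded Lie algebra are given by three linear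
maps which respect the brackets of the local Lie algebra. -/
theorem exists_lift (X : LocalLieAlgebra G₀ G₁ Gm) {L : Type*} [LieRing L] [LieAlgebra ℂ L]
    (f₁ : G₁ →ₗ[ℂ] L) (f₀ : G₀ →ₗ[ℂ] L) (fm : Gm →ₗ[ℂ] L)
    (h₀₀ : ∀ a b, f₀ ⁅a, b⁆ = ⁅f₀ a, f₀ b⁆) (h₀₁ : ∀ a x, f₁ ⁅a, x⁆ = ⁅f₀ a, f₁ x⁆)
    (h₀m : ∀ a y, fm ⁅a, y⁆ = ⁅f₀ a, fm y⁆) (h₁m : ∀ x y, f₀ (X.bracket x y) = ⁅f₁ x, fm y⁆) :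
    ∃ F : X.Maximal →ₗ⁅ℂ⁆ L,
      (∀ x, F (X.pos x) = f₁ x) ∧ (∀ a, F (X.zero a) = f₀ a) ∧ ∀ y, F (X.neg y) = fm y := by
  let g : X.Free →ₗ⁅ℂ⁆ L := FreeLieAlgebra.lift ℂ (Sum.elim f₁ (Sum.elim f₀ fm))
  have gp (x) : g (X.freePos x) = f₁ x := FreeLieAlgebra.lift_of_apply _ _
  have gz (a) : g (X.freeZero a) = f₀ a := FreeLieAlgebra.lift_of_apply _ _
  have gn (y) : g (X.freeNeg y) = fm y := FreeLieAlgebra.lift_of_apply _ _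
  have hg : X.relationIdeal ≤ g.ker := by
    refine LieSubmodule.lieSpan_le.2 fun z (hz : X.Relator z) => ?_
    change g z = 0
    induction hz <;>
      simp only [map_sub, map_add, map_smul, LieHom.map_lie, gp, gz, gn, h₀₀, h₀₁, h₀m, h₁m,
        sub_self]
  let F : X.Maximal →ₗ[ℂ] L := X.relationIdeal.toSubmodule.liftQ (g : X.Free →ₗ[ℂ] L) hg
  refine ⟨{ F with map_lie' := ?_ }, gp, gz, gn⟩
  rintro ⟨u⟩ ⟨v⟩
  exact g.map_lie u v

@[elab_as_elim]
theorem maximal_induction (X : LocalLieAlgebra G₀ G₁ Gm) {p : X.Maximal → Prop}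
    (pos : ∀ x, p (X.pos x)) (zero : ∀ a, p (X.zero a)) (neg : ∀ y, p (X.neg y))
    (add : ∀ u v, p u → p v → p (u + v)) (smul : ∀ (c : ℂ) u, p u → p (c • u))
    (lie : ∀ u v, p u → p v → p ⁅u, v⁆) (u : X.Maximal) : p u := by
  let K : LieSubalgebra ℂ X.Maximal :=
    { carrier := {u | p u}
      add_mem' := fun {u v} => add u v
      zero_mem' := by simpa using smul 0 _ (zero 0)
      smul_mem' := smul
      lie_mem' := fun {u v} => lie u v }
  let mk : X.Free →ₗ⁅ℂ⁆ X.Maximal :=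
    { X.relationIdeal.toSubmodule.mkQ with map_lie' := fun {_ _} => rfl }
  let f : X.Free →ₗ⁅ℂ⁆ K := FreeLieAlgebra.lift ℂ (Sum.elim (fun x => ⟨X.pos x, pos x⟩)
    (Sum.elim (fun a => ⟨X.zero a, zero a⟩) (fun y => ⟨X.neg y, neg y⟩)))
  have h : K.incl.comp f = mk := by
    refine FreeLieAlgebra.hom_ext fun s => ?_
    rw [LieHom.comp_apply, FreeLieAlgebra.lift_of_apply]
    rcases s with x | a | y <;> rfl
  obtain ⟨w⟩ := u
  have hw : (f w : X.Maximal) = mk w := LieHom.congr_fun h w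
  exact (congrArg p hw).mp (f w).2

/-- A subspace stable under the generators is an ideal. -/
theorem lie_mem_of_stable (X : LocalLieAlgebra G₀ G₁ Gm) {J : Submodule ℂ X.Maximal}
    (pos : ∀ x, ∀ w ∈ J, ⁅X.pos x, w⁆ ∈ J) (zero : ∀ a, ∀ w ∈ J, ⁅X.zero a, w⁆ ∈ J)
    (neg : ∀ y, ∀ w ∈ J, ⁅X.neg y, w⁆ ∈ J) (u : X.Maximal) : ∀ w ∈ J, ⁅u, w⁆ ∈ J := by
  induction u using X.maximal_induction with
  | pos x => exact pos x
  | zero a => exact zero a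
  | neg y => exact neg y
  | add u v hu hv => intro w hw; rw [add_lie]; exact J.add_mem (hu w hw) (hv w hw)
  | smul c u hu => intro w hw; rw [smul_lie]; exact J.smul_mem c (hu w hw)
  | lie u v hu hv =>
    intro w hw
    rw [lie_lie]
    exact J.sub_mem (hu _ (hv w hw)) (hv _ (hu w hw))

/-! ### The grading -/

theorem pos_mem_component (X : LocalLieAlgebra G₀ G₁ Gm) (x : G₁) : X.pos x ∈ X.component 1 :=
  Submodule.subset_span (.pos x)

theorem zero_mem_component (X : LocalLieAlgebra G₀ G₁ Gm) (a : G₀) : X.zero a ∈ X.component 0 :=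
  Submodule.subset_span (.zero a)

theorem neg_mem_component (X : LocalLieAlgebra G₀ G₁ Gm) (y : Gm) : X.neg y ∈ X.component (-1) :=
  Submodule.subset_span (.neg y)

theorem lie_mem_component (X : LocalLieAlgebra G₀ G₁ Gm) {i j : ℤ} {u v : X.Maximal}
    (hu : u ∈ X.component i) (hv : v ∈ X.component j) : ⁅u, v⁆ ∈ X.component (i + j) := by
  have h : X.component j ≤ (X.component (i + j)).comap (LieAlgebra.ad ℂ X.Maximal u) := by
    refine Submodule.span_le.2 fun v hv => ?_
    change ⁅u, v⁆ ∈ X.component (i + j)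
    induction hu using Submodule.span_induction with
    | mem u hu => exact Submodule.subset_span (.lie hu hv)
    | zero => rw [zero_lie]; exact Submodule.zero_mem _
    | add u u' _ _ hu hu' => rw [add_lie]; exact Submodule.add_mem _ hu hu'
    | smul c u _ hu => rw [smul_lie]; exact Submodule.smul_mem _ c hu
  exact h hv

/-- An element of `G₀` whose adjoint action on the local part is multiplication by the degree. -/
structure IsEuler (_X : LocalLieAlgebra G₀ G₁ Gm) (E : G₀) : Prop where
  lie_zero : ∀ a : G₀, ⁅E, a⁆ = 0
  lie_pos : ∀ x : G₁, ⁅E, x⁆ = x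
  lie_neg : ∀ y : Gm, ⁅E, y⁆ = -y

theorem IsEuler.component_le_eigenspace {X : LocalLieAlgebra G₀ G₁ Gm} {E : G₀} (hE : X.IsEuler E)
    (i : ℤ) : X.component i ≤ (LieAlgebra.ad ℂ X.Maximal (X.zero E)).eigenspace (i : ℂ) := by
  refine Submodule.span_le.2 fun u (hu : X.IsMonomial i u) => ?_
  rw [SetLike.mem_coe, Module.End.mem_eigenspace_iff, LieAlgebra.ad_apply]
  induction hu with
  | pos x => rw [lie_zero_pos, hE.lie_pos, Int.cast_one, one_smul]
  | zero a =>
    rw [lie_zero_zero, hE.lie_zero, Int.cast_zero, zero_smul]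
    exact X.zeroLinear.map_zero
  | neg y =>
    rw [lie_zero_neg, hE.lie_neg, Int.cast_neg, Int.cast_one, neg_smul, one_smul]
    exact X.negLinear.map_neg y
  | lie _ _ hu hv =>
    rw [leibniz_lie, hu, hv, smul_lie, lie_smul, ← add_smul, Int.cast_add]

theorem IsEuler.iSupIndep_component {X : LocalLieAlgebra G₀ G₁ Gm} {E : G₀} (hE : X.IsEuler E) :
    iSupIndep X.component :=
  ((Module.End.eigenspaces_iSupIndep _).comp Int.cast_injective).mono hE.component_le_eigenspace

end

end LocalLieAlgebra

/-! ### Closures under iterated brackets -/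

section adClosure

variable {R M : Type*} [CommRing R] [LieRing M] [LieAlgebra R M]

/-- The smallest subspace of a Lie algebra that contains `U` and is stable under bracketing with
the elements of `A` from the left. -/
def adClosure (A : Set M) (U : Submodule R M) : Submodule R M :=
  sInf {W | U ≤ W ∧ ∀ a ∈ A, ∀ w ∈ W, ⁅a, w⁆ ∈ W}

theorem le_adClosure (A : Set M) (U : Submodule R M) : U ≤ adClosure A U :=
  le_sInf fun _ hW => hW.1

theorem lie_mem_adClosure {A : Set M} {U : Submodule R M} {a w : M} (ha : a ∈ A)
    (hw : w ∈ adClosure A U) : ⁅a, w⁆ ∈ adClosure A U := by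
  rw [adClosure, Submodule.mem_sInf] at hw ⊢
  exact fun W hW => hW.2 a ha w (hw W hW)

@[elab_as_elim]
theorem adClosure_induction {A : Set M} {U : Submodule R M}
    {p : (w : M) → w ∈ adClosure A U → Prop}
    (mem : ∀ u (hu : u ∈ U), p u (le_adClosure A U hu))
    (add : ∀ v w hv hw, p v hv → p w hw → p (v + w) (Submodule.add_mem _ hv hw))
    (smul : ∀ (c : R) w hw, p w hw → p (c • w) (Submodule.smul_mem _ c hw))
    (lie : ∀ a (ha : a ∈ A) w hw, p w hw → p ⁅a, w⁆ (lie_mem_adClosure ha hw)) {w : M}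
    (hw : w ∈ adClosure A U) : p w hw := by
  let W : Submodule R M :=
    { carrier := {w | ∃ hw, p w hw}
      add_mem' := fun ⟨_, hv⟩ ⟨_, hw⟩ => ⟨_, add _ _ _ _ hv hw⟩
      zero_mem' := ⟨_, mem 0 U.zero_mem⟩
      smul_mem' := fun c w ⟨_, hw⟩ => ⟨_, smul c w _ hw⟩ }
  have h : adClosure A U ≤ W := sInf_le ⟨fun u hu => ⟨_, mem u hu⟩,
    fun a ha w ⟨_, hw⟩ => ⟨_, lie a ha w _ hw⟩⟩
  exact (h hw).2

/-- If `A` and `U` are normalized by `z`, then so is the closure of `U` under `A`. -/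
theorem lie_mem_adClosure_of_normalizes {A : Set M} {U : Submodule R M} {z : M}
    (hA : ∀ a ∈ A, ⁅z, a⁆ ∈ A) (hU : ∀ u ∈ U, ⁅z, u⁆ ∈ U) {w : M} (hw : w ∈ adClosure A U) :
    ⁅z, w⁆ ∈ adClosure A U := by
  induction hw using adClosure_induction with
  | mem u hu => exact le_adClosure A U (hU u hu)
  | add v w _ _ hv hw => rw [lie_add]; exact Submodule.add_mem _ hv hw
  | smul c w _ hw => rw [lie_smul]; exact Submodule.smul_mem _ c hw
  | lie a ha w hw ih =>
    rw [leibniz_lie]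
    exact Submodule.add_mem _ (lie_mem_adClosure (hA a ha) hw) (lie_mem_adClosure ha ih)

/-- In a local Lie algebra `B ⊕ Z ⊕ A`, the algebra generated by `A` is mapped by `B` into itself
plus `Z`. -/
theorem lie_mem_adClosure_sup {A Z B : Submodule R M} (hZA : ∀ z ∈ Z, ∀ a ∈ A, ⁅z, a⁆ ∈ A)
    (hBA : ∀ b ∈ B, ∀ a ∈ A, ⁅b, a⁆ ∈ Z) {b w : M} (hb : b ∈ B)
    (hw : w ∈ adClosure (A : Set M) A) : ⁅b, w⁆ ∈ adClosure (A : Set M) A ⊔ Z := by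
  induction hw using adClosure_induction with
  | mem u hu => exact Submodule.mem_sup_right (hBA b hb u hu)
  | add v w _ _ hv hw => rw [lie_add]; exact Submodule.add_mem _ hv hw
  | smul c w _ hw => rw [lie_smul]; exact Submodule.smul_mem _ c hw
  | lie a ha w hw ih =>
    obtain ⟨q, hq, z, hz, hqz⟩ := Submodule.mem_sup.1 ih
    rw [leibniz_lie, ← hqz, lie_add, ← lie_skew a z]
    refine Submodule.mem_sup_left (Submodule.add_mem _ ?_ (Submodule.add_mem _ ?_ ?_))
    · exact lie_mem_adClosure_of_normalizes (hZA _ (hBA b hb a ha)) (hZA _ (hBA b hb a ha)) hw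
    · exact lie_mem_adClosure ha hq
    · exact le_adClosure _ _ (A.neg_mem (hZA z hz a ha))

/-- In a local Lie algebra `B ⊕ Z ⊕ A`, if `B` maps `U` into `N`, then it maps everything that is
generated from `U` by `A` and `Z` into itself plus `N`. -/
theorem lie_mem_adClosure_union_sup {A Z B U N : Submodule R M}
    (hBZ : ∀ b ∈ B, ∀ z ∈ Z, ⁅b, z⁆ ∈ B) (hBA : ∀ b ∈ B, ∀ a ∈ A, ⁅b, a⁆ ∈ Z)
    (hU : ∀ b ∈ B, ∀ u ∈ U, ⁅b, u⁆ ∈ N) (hN : ∀ m : M, ∀ w ∈ N, ⁅m, w⁆ ∈ N) {b w : M} (hb : b ∈ B)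
    (hw : w ∈ adClosure (A ∪ Z : Set M) U) : ⁅b, w⁆ ∈ adClosure (A ∪ Z : Set M) U ⊔ N := by
  induction hw using adClosure_induction generalizing b with
  | mem u hu => exact Submodule.mem_sup_right (hU b hb u hu)
  | add v w _ _ hv hw => rw [lie_add]; exact Submodule.add_mem _ (hv hb) (hw hb)
  | smul c w _ hw => rw [lie_smul]; exact Submodule.smul_mem _ c (hw hb)
  | lie a ha w hw ih =>
    rw [leibniz_lie]
    refine Submodule.add_mem _ ?_ ?_
    · rcases ha with ha | ha
      · exact Submodule.mem_sup_left (lie_mem_adClosure (Or.inr (hBA b hb a ha)) hw)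
      · exact ih (hBZ b hb a ha)
    · obtain ⟨s, hs, m, hm, hsm⟩ := Submodule.mem_sup.1 (ih hb)
      rw [← hsm, lie_add]
      exact Submodule.add_mem _ (Submodule.mem_sup_left (lie_mem_adClosure ha hs))
        (Submodule.mem_sup_right (hN a m hm))

/-- If `U` is graded with degrees in `T`, and `A` consists of homogeneous elements whose degrees
`d` satisfy `T + d ⊆ T`, then the closure of `U` under `A` is graded with degrees in `T`. -/
theorem adClosure_le_iSup {𝒞 : ℤ → Submodule R M} {T : Set ℤ} {A : Set M} {U : Submodule R M}
    (hU : U ≤ ⨆ j ∈ T, U ⊓ 𝒞 j)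
    (hA : ∀ a ∈ A, ∃ d : ℤ, (∀ j ∈ T, d + j ∈ T) ∧ ∀ j, ∀ w ∈ 𝒞 j, ⁅a, w⁆ ∈ 𝒞 (d + j)) :
    adClosure A U ≤ ⨆ j ∈ T, adClosure A U ⊓ 𝒞 j := by
  intro w hw
  induction hw using adClosure_induction with
  | mem u hu => exact iSup₂_mono (fun j _ => inf_le_inf_right _ (le_adClosure A U)) (hU hu)
  | add v w _ _ hv hw => exact Submodule.add_mem _ hv hw
  | smul c w _ hw => exact Submodule.smul_mem _ c hw
  | lie a ha w hw ih =>
    obtain ⟨d, hd, h⟩ := hA a ha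
    have key : (⨆ j ∈ T, adClosure A U ⊓ 𝒞 j) ≤
        (⨆ j ∈ T, adClosure A U ⊓ 𝒞 j).comap (LieAlgebra.ad R M a) :=
      iSup₂_le fun j hj v hv => Submodule.mem_iSup_of_mem (d + j) <|
        Submodule.mem_iSup_of_mem (hd j hj) ⟨lie_mem_adClosure ha hv.1, h j v hv.2⟩
    exact key ih

end adClosure

namespace LocalLieAlgebra

section

variable {G₀ G₁ Gm : Type*}
    [LieRing G₀] [LieAlgebra ℂ G₀]
    [AddCommGroup G₁] [Module ℂ G₁] [LieRingModule G₀ G₁] [LieModule ℂ G₀ G₁]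
    [AddCommGroup Gm] [Module ℂ Gm] [LieRingModule G₀ Gm] [LieModule ℂ G₀ Gm]

/-! ### The brackets of the local part inside the maximal graded Lie algebra -/

theorem lie_zero_range_pos (X : LocalLieAlgebra G₀ G₁ Gm) :
    ∀ z ∈ LinearMap.range X.zeroLinear, ∀ a ∈ LinearMap.range X.posLinear,
      ⁅z, a⁆ ∈ LinearMap.range X.posLinear := by
  rintro _ ⟨a, rfl⟩ _ ⟨x, rfl⟩
  exact ⟨⁅a, x⁆, (X.lie_zero_pos a x).symm⟩

theorem lie_zero_range_neg (X : LocalLieAlgebra G₀ G₁ Gm) :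
    ∀ z ∈ LinearMap.range X.zeroLinear, ∀ b ∈ LinearMap.range X.negLinear,
      ⁅z, b⁆ ∈ LinearMap.range X.negLinear := by
  rintro _ ⟨a, rfl⟩ _ ⟨y, rfl⟩
  exact ⟨⁅a, y⁆, (X.lie_zero_neg a y).symm⟩

theorem lie_range_pos_neg (X : LocalLieAlgebra G₀ G₁ Gm) :
    ∀ a ∈ LinearMap.range X.posLinear, ∀ b ∈ LinearMap.range X.negLinear,
      ⁅a, b⁆ ∈ LinearMap.range X.zeroLinear := by
  rintro _ ⟨x, rfl⟩ _ ⟨y, rfl⟩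
  exact ⟨X.bracket x y, (X.lie_pos_neg x y).symm⟩

theorem lie_range_neg_pos (X : LocalLieAlgebra G₀ G₁ Gm) :
    ∀ b ∈ LinearMap.range X.negLinear, ∀ a ∈ LinearMap.range X.posLinear,
      ⁅b, a⁆ ∈ LinearMap.range X.zeroLinear := fun b hb a ha => by
  rw [← lie_skew]
  exact Submodule.neg_mem _ (X.lie_range_pos_neg a ha b hb)

theorem lie_mem_component_of_mem_range_pos (X : LocalLieAlgebra G₀ G₁ Gm) {a : X.Maximal}
    (ha : a ∈ LinearMap.range X.posLinear) (j : ℤ) :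
    ∀ w ∈ X.component j, ⁅a, w⁆ ∈ X.component (1 + j) := by
  obtain ⟨x, rfl⟩ := ha
  exact fun w hw => X.lie_mem_component (X.pos_mem_component x) hw

theorem lie_mem_component_of_mem_range_zero (X : LocalLieAlgebra G₀ G₁ Gm) {a : X.Maximal}
    (ha : a ∈ LinearMap.range X.zeroLinear) (j : ℤ) :
    ∀ w ∈ X.component j, ⁅a, w⁆ ∈ X.component (0 + j) := by
  obtain ⟨x, rfl⟩ := ha
  exact fun w hw => X.lie_mem_component (X.zero_mem_component x) hw

theorem lie_mem_component_of_mem_range_neg (X : LocalLieAlgebra G₀ G₁ Gm) {a : X.Maximal}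
    (ha : a ∈ LinearMap.range X.negLinear) (j : ℤ) :
    ∀ w ∈ X.component j, ⁅a, w⁆ ∈ X.component (-1 + j) := by
  obtain ⟨x, rfl⟩ := ha
  exact fun w hw => X.lie_mem_component (X.neg_mem_component x) hw

/-- The maximal graded Lie algebra is the sum of the image of `G₀` and of the components of non-zero
degree: the sum of this image and of the algebras generated by `G₁` and by `G₋₁` is stable under
bracketing with the local part. -/
theorem range_zero_sup_iSup_component (X : LocalLieAlgebra G₀ G₁ Gm) :
    LinearMap.range X.zeroLinear ⊔ ⨆ i ∈ ({0}ᶜ : Set ℤ), X.component i = ⊤ := by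
  set A := LinearMap.range X.posLinear
  set Z := LinearMap.range X.zeroLinear
  set B := LinearMap.range X.negLinear
  have hA : adClosure (A : Set X.Maximal) A ≤ ⨆ i ∈ Set.Ici (1 : ℤ), X.component i := by
    refine (adClosure_le_iSup (𝒞 := X.component) (T := Set.Ici 1) ?_ fun a ha => ⟨1, ?_, ?_⟩).trans
      (iSup₂_mono fun _ _ => inf_le_right)
    · rintro _ ⟨x, rfl⟩
      exact Submodule.mem_iSup_of_mem 1 <| Submodule.mem_iSup_of_mem (Set.mem_Ici.2 le_rfl)
        ⟨⟨x, rfl⟩, X.pos_mem_component x⟩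
    · exact fun j (hj : 1 ≤ j) => (show 1 ≤ 1 + j by omega)
    · exact X.lie_mem_component_of_mem_range_pos ha
  have hB : adClosure (B : Set X.Maximal) B ≤ ⨆ i ∈ Set.Iic (-1 : ℤ), X.component i := by
    refine (adClosure_le_iSup (𝒞 := X.component) (T := Set.Iic (-1)) ?_
      fun a ha => ⟨-1, ?_, ?_⟩).trans (iSup₂_mono fun _ _ => inf_le_right)
    · rintro _ ⟨y, rfl⟩
      exact Submodule.mem_iSup_of_mem (-1) <| Submodule.mem_iSup_of_mem (Set.mem_Iic.2 le_rfl)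
        ⟨⟨y, rfl⟩, X.neg_mem_component y⟩
    · exact fun j (hj : j ≤ -1) => (show -1 + j ≤ -1 by omega)
    · exact X.lie_mem_component_of_mem_range_neg ha
  set W := Z ⊔ (adClosure (A : Set X.Maximal) A ⊔ adClosure (B : Set X.Maximal) B)
  have hZW : Z ≤ W := le_sup_left
  have hAW : adClosure (A : Set X.Maximal) A ≤ W := le_sup_left.trans le_sup_right
  have hBW : adClosure (B : Set X.Maximal) B ≤ W := le_sup_right.trans le_sup_right
  have hpos (x : G₁) : X.pos x ∈ A := ⟨x, rfl⟩
  have hzero (a : G₀) : X.zero a ∈ Z := ⟨a, rfl⟩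
  have hneg (y : Gm) : X.neg y ∈ B := ⟨y, rfl⟩
  -- a linear map which sends the three summands of `W` into `W` stabilizes `W`
  have hW (m : X.Maximal) (h₀ : ∀ w ∈ Z, ⁅m, w⁆ ∈ W)
      (h₁ : ∀ w ∈ adClosure (A : Set X.Maximal) A, ⁅m, w⁆ ∈ W)
      (h₂ : ∀ w ∈ adClosure (B : Set X.Maximal) B, ⁅m, w⁆ ∈ W) : ∀ w ∈ W, ⁅m, w⁆ ∈ W := by
    have : W ≤ W.comap (LieAlgebra.ad ℂ X.Maximal m) := sup_le h₀ (sup_le h₁ h₂)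
    exact this
  have hstable : ∀ u : X.Maximal, ∀ w ∈ W, ⁅u, w⁆ ∈ W := by
    refine X.lie_mem_of_stable (fun x => hW _ ?_ ?_ ?_) (fun a => hW _ ?_ ?_ ?_)
      (fun y => hW _ ?_ ?_ ?_)
    · intro z hz
      rw [← lie_skew]
      exact W.neg_mem (hAW (le_adClosure _ _ (X.lie_zero_range_pos z hz _ (hpos x))))
    · exact fun w hw => hAW (lie_mem_adClosure (hpos x) hw)
    · exact fun w hw => sup_le hBW hZW
        (lie_mem_adClosure_sup X.lie_zero_range_neg X.lie_range_pos_neg (hpos x) hw)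
    · rintro _ ⟨b, rfl⟩
      exact hZW ⟨⁅a, b⁆, (X.lie_zero_zero a b).symm⟩
    · exact fun w hw => hAW (lie_mem_adClosure_of_normalizes
        (X.lie_zero_range_pos _ (hzero a)) (X.lie_zero_range_pos _ (hzero a)) hw)
    · exact fun w hw => hBW (lie_mem_adClosure_of_normalizes
        (X.lie_zero_range_neg _ (hzero a)) (X.lie_zero_range_neg _ (hzero a)) hw)
    · intro z hz
      rw [← lie_skew]
      exact W.neg_mem (hBW (le_adClosure _ _ (X.lie_zero_range_neg z hz _ (hneg y))))
    · exact fun w hw => sup_le hAW hZW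
        (lie_mem_adClosure_sup X.lie_zero_range_pos X.lie_range_neg_pos (hneg y) hw)
    · exact fun w hw => hBW (lie_mem_adClosure (hneg y) hw)
  have htop : ∀ u : X.Maximal, u ∈ W := fun u => by
    induction u using X.maximal_induction with
    | pos x => exact hAW (le_adClosure _ _ (hpos x))
    | zero a => exact hZW (hzero a)
    | neg y => exact hBW (le_adClosure _ _ (hneg y))
    | add u v hu hv => exact W.add_mem hu hv
    | smul c u hu => exact W.smul_mem c hu
    | lie u v hu hv => exact hstable u v hv
  refine eq_top_iff.2 (le_trans (fun u _ => htop u) (sup_le_sup_left (sup_le ?_ ?_) Z))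
  · exact hA.trans (biSup_mono fun i (hi : 1 ≤ i) => (show i ≠ 0 by omega))
  · exact hB.trans (biSup_mono fun i (hi : i ≤ -1) => (show i ≠ 0 by omega))

/-! ### The minimal ideal -/

theorem isGradedIdeal_far (X : LocalLieAlgebra G₀ G₁ Gm) {I : LieIdeal ℂ X.Maximal}
    (hI : X.IsGradedIdeal I)
    (hd : I.toSubmodule ⊓ (X.component (-1) ⊔ X.component 0 ⊔ X.component 1) = ⊥) :
    I.toSubmodule ≤ ⨆ i ∈ {i : ℤ | 2 ≤ |i|}, I.toSubmodule ⊓ X.component i := by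
  refine hI.trans (iSup_le fun i => ?_)
  by_cases hi : 2 ≤ |i|
  · exact le_biSup (fun i => I.toSubmodule ⊓ X.component i) hi
  · have hc : X.component i ≤ X.component (-1) ⊔ X.component 0 ⊔ X.component 1 := by
      have : i = -1 ∨ i = 0 ∨ i = 1 := by rw [not_le, abs_lt] at hi; omega
      rcases this with rfl | rfl | rfl
      · exact le_sup_left.trans le_sup_left
      · exact le_sup_right.trans le_sup_left
      · exact le_sup_right
    exact ((inf_le_inf_left _ hc).trans hd.le).trans bot_le

/-- The minimal ideal is graded, with all its degrees outside of `{-1, 0, 1}`. -/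
theorem minimalIdeal_far (X : LocalLieAlgebra G₀ G₁ Gm) :
    X.minimalIdeal.toSubmodule ≤
      ⨆ i ∈ {i : ℤ | 2 ≤ |i|}, X.minimalIdeal.toSubmodule ⊓ X.component i := by
  conv_lhs => rw [minimalIdeal, LieSubmodule.sSup_toSubmodule_eq_iSup]
  refine iSup₂_le fun I hI => (X.isGradedIdeal_far hI.1 hI.2).trans ?_
  refine iSup₂_mono fun i _ => inf_le_inf_right _ ?_
  exact (LieSubmodule.toSubmodule_le_toSubmodule _ _).2 (le_sSup hI)

theorem IsEuler.disjoint_far {X : LocalLieAlgebra G₀ G₁ Gm} {E : G₀} (hE : X.IsEuler E)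
    {J : Submodule ℂ X.Maximal} (hJ : J ≤ ⨆ i ∈ {i : ℤ | 2 ≤ |i|}, J ⊓ X.component i) :
    Disjoint J (X.component (-1) ⊔ X.component 0 ⊔ X.component 1) := by
  have hd : Disjoint {i : ℤ | 2 ≤ |i|} {-1, 0, 1} := by
    rw [Set.disjoint_right]
    rintro i (rfl | rfl | rfl) <;> simp
  refine (hE.iSupIndep_component.disjoint_biSup_biSup hd).mono
    (hJ.trans (iSup₂_mono fun _ _ => inf_le_right)) ?_
  refine sup_le (sup_le ?_ ?_) ?_ <;> exact le_biSup X.component (by simp)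

/-- Elements of the minimal ideal of degree `-1`, `0` or `1` vanish. -/
theorem IsEuler.disjoint_minimalIdeal {X : LocalLieAlgebra G₀ G₁ Gm} {E : G₀} (hE : X.IsEuler E) :
    Disjoint X.minimalIdeal.toSubmodule (X.component (-1) ⊔ X.component 0 ⊔ X.component 1) :=
  hE.disjoint_far X.minimalIdeal_far

theorem IsEuler.le_minimalIdeal {X : LocalLieAlgebra G₀ G₁ Gm} {E : G₀} (hE : X.IsEuler E)
    {J : Submodule ℂ X.Maximal} (hJ : J ≤ ⨆ i ∈ {i : ℤ | 2 ≤ |i|}, J ⊓ X.component i)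
    (hstable : ∀ u : X.Maximal, ∀ w ∈ J, ⁅u, w⁆ ∈ J) : J ≤ X.minimalIdeal.toSubmodule := by
  let I : LieIdeal ℂ X.Maximal := { J with lie_mem := fun {u w} hw => hstable u w hw }
  have hI : I ≤ X.minimalIdeal := le_sSup ⟨hJ.trans (iSup₂_le fun i _ => le_iSup
    (fun i => J ⊓ X.component i) i), (hE.disjoint_far hJ).eq_bot⟩
  exact hI

/-- The ideal generated by the minimal ideal and an element `u` of degree `≥ 2` that commutes with
`G₋₁` modulo the minimal ideal only has degrees `≥ 2`, besides those of the minimal ideal. So it is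
again an ideal that misses the local part. The same holds with the signs exchanged. -/
theorem IsEuler.isTransitiveIdeal_minimalIdeal {X : LocalLieAlgebra G₀ G₁ Gm} {E : G₀}
    (hE : X.IsEuler E) : X.IsTransitiveIdeal X.minimalIdeal := by
  set N := X.minimalIdeal.toSubmodule with hN
  have hNlie : ∀ m : X.Maximal, ∀ w ∈ N, ⁅m, w⁆ ∈ N := fun m w hw => X.minimalIdeal.lie_mem hw
  set Z := LinearMap.range X.zeroLinear
  -- the argument for both signs: `A` has degree `d = ± 1` and `T` consists of the degrees `≥ 2`
  -- or of the degrees `≤ -2`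
  have key (A B : Submodule ℂ X.Maximal) (d : ℤ) (T : Set ℤ) (hT : ∀ i ∈ T, d + i ∈ T)
      (hT2 : ∀ i ∈ T, 2 ≤ |i|)
      (hA : ∀ a ∈ A, ∀ j, ∀ w ∈ X.component j, ⁅a, w⁆ ∈ X.component (d + j))
      (hZB : ∀ z ∈ Z, ∀ b ∈ B, ⁅z, b⁆ ∈ B) (hBA : ∀ b ∈ B, ∀ a ∈ A, ⁅b, a⁆ ∈ Z)
      (hgen : ∀ J : Submodule ℂ X.Maximal, (∀ a ∈ A, ∀ w ∈ J, ⁅a, w⁆ ∈ J) →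
        (∀ z ∈ Z, ∀ w ∈ J, ⁅z, w⁆ ∈ J) → (∀ b ∈ B, ∀ w ∈ J, ⁅b, w⁆ ∈ J) →
        ∀ m : X.Maximal, ∀ w ∈ J, ⁅m, w⁆ ∈ J)
      (i : ℤ) (hi : i ∈ T) (u : X.Maximal) (hu : u ∈ X.component i)
      (hBu : ∀ b ∈ B, ⁅b, u⁆ ∈ N) : u ∈ N := by
    set U := Submodule.span ℂ {u} with hU
    set S := adClosure (A ∪ Z : Set X.Maximal) U
    have hBU : ∀ b ∈ B, ∀ v ∈ U, ⁅b, v⁆ ∈ N := by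
      intro b hb v hv
      obtain ⟨c, rfl⟩ := Submodule.mem_span_singleton.1 hv
      rw [lie_smul]
      exact N.smul_mem c (hBu b hb)
    have hSfar : S ≤ ⨆ j ∈ T, S ⊓ X.component j := by
      refine adClosure_le_iSup ?_ ?_
      · rw [hU, Submodule.span_singleton_le_iff_mem]
        exact Submodule.mem_iSup_of_mem i <| Submodule.mem_iSup_of_mem hi
          ⟨Submodule.mem_span_singleton_self u, hu⟩
      · rintro a (ha | ha)
        · exact ⟨d, hT, hA a ha⟩
        · exact ⟨0, fun j hj => (zero_add j).symm ▸ hj, X.lie_mem_component_of_mem_range_zero ha⟩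
    have hsup (m : X.Maximal) (hm : ∀ w ∈ S, ⁅m, w⁆ ∈ S ⊔ N) : ∀ w ∈ S ⊔ N, ⁅m, w⁆ ∈ S ⊔ N := by
      have : S ⊔ N ≤ (S ⊔ N).comap (LieAlgebra.ad ℂ X.Maximal m) :=
        sup_le hm fun w hw => Submodule.mem_sup_right (hNlie m w hw)
      exact this
    have hstable : ∀ m : X.Maximal, ∀ w ∈ S ⊔ N, ⁅m, w⁆ ∈ S ⊔ N := by
      refine hgen _ (fun a ha => hsup a fun w hw => ?_) (fun z hz => hsup z fun w hw => ?_)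
        (fun b hb => hsup b fun w hw => ?_)
      · exact Submodule.mem_sup_left (lie_mem_adClosure (Or.inl ha) hw)
      · exact Submodule.mem_sup_left (lie_mem_adClosure (Or.inr hz) hw)
      · refine lie_mem_adClosure_union_sup (B := B) (fun b hb z hz => ?_) hBA hBU hNlie hb hw
        rw [← lie_skew]
        exact B.neg_mem (hZB z hz b hb)
    have hfar : S ⊔ N ≤ ⨆ j ∈ {j : ℤ | 2 ≤ |j|}, (S ⊔ N) ⊓ X.component j := by
      refine sup_le ?_ ?_
      · exact hSfar.trans ((iSup₂_mono fun j _ => inf_le_inf_right _ le_sup_left).trans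
          (biSup_mono hT2))
      · exact X.minimalIdeal_far.trans (iSup₂_mono fun j _ => inf_le_inf_right _ le_sup_right)
    exact hE.le_minimalIdeal hfar hstable
      (Submodule.mem_sup_left (le_adClosure _ _ (Submodule.mem_span_singleton_self u)))
  have hlie_skew {u v : X.Maximal} (h : ⁅u, v⁆ ∈ X.minimalIdeal) : ⁅v, u⁆ ∈ N := by
    rw [← lie_skew]
    exact N.neg_mem h
  constructor
  · intro i hi u hu hy
    refine key (LinearMap.range X.posLinear) (LinearMap.range X.negLinear) 1 (Set.Ici 2)
      (fun j (hj : 2 ≤ j) => show 2 ≤ 1 + j by omega)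
      (fun j (hj : 2 ≤ j) => hj.trans (le_abs_self j))
      (fun a ha => X.lie_mem_component_of_mem_range_pos ha) X.lie_zero_range_neg
      X.lie_range_neg_pos (fun J h₁ h₂ h₃ => X.lie_mem_of_stable (fun x => h₁ _ ⟨x, rfl⟩)
        (fun a => h₂ _ ⟨a, rfl⟩) fun y => h₃ _ ⟨y, rfl⟩) i hi u hu ?_
    rintro _ ⟨y, rfl⟩
    exact hlie_skew (hy y)
  · intro i hi u hu hx
    refine key (LinearMap.range X.negLinear) (LinearMap.range X.posLinear) (-1) (Set.Iic (-2))
      (fun j (hj : j ≤ -2) => show -1 + j ≤ -2 by omega)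
      (fun j (hj : j ≤ -2) => (show 2 ≤ -j by omega).trans (neg_le_abs j))
      (fun a ha => X.lie_mem_component_of_mem_range_neg ha) X.lie_zero_range_pos
      X.lie_range_pos_neg (fun J h₁ h₂ h₃ => X.lie_mem_of_stable (fun x => h₃ _ ⟨x, rfl⟩)
        (fun a => h₂ _ ⟨a, rfl⟩) fun y => h₁ _ ⟨y, rfl⟩) i hi u hu ?_
    rintro _ ⟨x, rfl⟩
    exact hlie_skew (hx x)

/-- A central element of the minimal graded Lie algebra has degree `0` (the Euler element acts on
it by its degree), and a representative in `G₀` kills `G₁`. -/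
theorem IsEuler.exists_of_mem_center {X : LocalLieAlgebra G₀ G₁ Gm} {E : G₀} (hE : X.IsEuler E)
    {z : X.Minimal} (hz : z ∈ LieAlgebra.center ℂ X.Minimal) :
    ∃ a : G₀, z = LieSubmodule.Quotient.mk (X.zero a) ∧ ∀ x : G₁, X.pos ⁅a, x⁆ = 0 := by
  have hcomm : ∀ m : X.Minimal, ⁅m, z⁆ = 0 := hz
  let mk : X.Maximal →ₗ[ℂ] X.Minimal := X.minimalIdeal.toSubmodule.mkQ
  have hmk (u v : X.Maximal) : mk ⁅u, v⁆ = ⁅mk u, mk v⁆ := rfl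
  let e := (LieAlgebra.ad ℂ X.Minimal (mk (X.zero E))).eigenspace
  have he (i : ℤ) : X.component i ≤ (e i).comap mk := by
    intro u hu
    have h := hE.component_le_eigenspace i hu
    rw [Module.End.mem_eigenspace_iff, LieAlgebra.ad_apply] at h
    rw [Submodule.mem_comap, Module.End.mem_eigenspace_iff, LieAlgebra.ad_apply, ← hmk, h, map_smul]
  have hne : (⨆ i ∈ ({0}ᶜ : Set ℤ), X.component i) ≤ (⨆ c ∈ ({0}ᶜ : Set ℂ), e c).comap mk :=
    iSup₂_le fun i hi => (he i).trans <| Submodule.comap_mono <|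
      le_biSup e (show (i : ℂ) ∈ ({0}ᶜ : Set ℂ) by simpa using hi)
  obtain ⟨w, rfl⟩ : ∃ w, mk w = z := Submodule.mkQ_surjective _ z
  have hw : w ∈ LinearMap.range X.zeroLinear ⊔ ⨆ i ∈ ({0}ᶜ : Set ℤ), X.component i := by
    rw [X.range_zero_sup_iSup_component]
    trivial
  obtain ⟨_, ⟨a, rfl⟩, v, hv, rfl⟩ := Submodule.mem_sup.1 hw
  have h0 : mk (X.zero a) ∈ e 0 := by
    simpa using he 0 (X.zero_mem_component a)
  have hv0 : mk v ∈ e 0 := by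
    have h1 : mk (X.zeroLinear a + v) ∈ e 0 := by
      rw [Module.End.mem_eigenspace_iff, LieAlgebra.ad_apply, hcomm, zero_smul]
    rw [map_add] at h1
    exact (Submodule.add_mem_iff_right _ h0).1 h1
  have hvz : mk v = 0 := Submodule.disjoint_def.1
    ((Module.End.eigenspaces_iSupIndep (LieAlgebra.ad ℂ X.Minimal (mk (X.zero E)))) 0) _ hv0 (hne hv)
  refine ⟨a, by rw [map_add, hvz, add_zero]; rfl, fun x => ?_⟩
  have h : mk (X.pos ⁅a, x⁆) = 0 := by
    have h1 := hcomm (mk (X.pos x))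
    rw [map_add, hvz, add_zero, zeroLinear_apply, ← hmk, ← lie_skew, lie_zero_pos, map_neg,
      neg_eq_zero] at h1
    exact h1
  exact Submodule.disjoint_def.1 hE.disjoint_minimalIdeal _
    ((Submodule.Quotient.mk_eq_zero _).1 h) (Submodule.mem_sup_right (X.pos_mem_component _))

end

end LocalLieAlgebra

/-! ### Auxiliary facts on Lie algebras and tori -/

/-- A form of the first isomorphism theorem. -/
theorem exists_lieEquiv_of_ker_eq {R M L : Type*} [CommRing R] [LieRing M] [LieAlgebra R M]
    [LieRing L] [LieAlgebra R L] (f : M →ₗ⁅R⁆ L) (hf : Function.Surjective f) (I : LieIdeal R M)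
    (hI : f.ker = I) : Nonempty ((M ⧸ I) ≃ₗ⁅R⁆ L) := by
  subst hI
  exact ⟨f.quotKerEquivRange.trans ((LieEquiv.ofEq _ _ (congrArg _
    ((LieHom.range_eq_top f).2 hf))).trans LieSubalgebra.topEquiv)⟩

instance (r : ℕ) : IsLieAbelian (Torus r) := ⟨Torus.lie_eq_zero⟩

instance (r : ℕ) : FiniteDimensional ℂ (Torus r) :=
  inferInstanceAs (FiniteDimensional ℂ (Fin r → ℂ))

theorem finrank_torus (r : ℕ) : Module.finrank ℂ (Torus r) = r :=
  Module.finrank_fin_fun ℂ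

namespace LocalLieAlgebra

/-! ### Comparison of transitive and minimal ideals -/

section

variable {G₀ G₁ Gm H₀ H₁ Hm : Type*}
    [LieRing G₀] [LieAlgebra ℂ G₀]
    [AddCommGroup G₁] [Module ℂ G₁] [LieRingModule G₀ G₁] [LieModule ℂ G₀ G₁]
    [AddCommGroup Gm] [Module ℂ Gm] [LieRingModule G₀ Gm] [LieModule ℂ G₀ Gm]
    [LieRing H₀] [LieAlgebra ℂ H₀]
    [AddCommGroup H₁] [Module ℂ H₁] [LieRingModule H₀ H₁] [LieModule ℂ H₀ H₁]
    [AddCommGroup Hm] [Module ℂ Hm] [LieRingModule H₀ Hm] [LieModule ℂ H₀ Hm]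

/-- A homomorphism which preserves degrees on the local part preserves all degrees. -/
theorem map_mem_component {X : LocalLieAlgebra G₀ G₁ Gm} {Y : LocalLieAlgebra H₀ H₁ Hm}
    (f : X.Maximal →ₗ⁅ℂ⁆ Y.Maximal) (hpos : ∀ x, ∃ x', f (X.pos x) = Y.pos x')
    (hzero : ∀ a, ∃ a', f (X.zero a) = Y.zero a') (hneg : ∀ y, ∃ y', f (X.neg y) = Y.neg y')
    {i : ℤ} {u : X.Maximal} (hu : u ∈ X.component i) : f u ∈ Y.component i := by
  have h (i : ℤ) : X.component i ≤ (Y.component i).comap (f : X.Maximal →ₗ[ℂ] Y.Maximal) := by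
    refine Submodule.span_le.2 fun u (hu : X.IsMonomial i u) => ?_
    change f u ∈ Y.component i
    induction hu with
    | pos x =>
      obtain ⟨x', hx⟩ := hpos x
      exact hx ▸ Y.pos_mem_component x'
    | zero a =>
      obtain ⟨a', ha⟩ := hzero a
      exact ha ▸ Y.zero_mem_component a'
    | neg y =>
      obtain ⟨y', hy⟩ := hneg y
      exact hy ▸ Y.neg_mem_component y'
    | lie _ _ hu hv =>
      rw [LieHom.map_lie]
      exact Y.lie_mem_component hu hv
  exact h i hu

/-- A homomorphism to an abelian Lie algebra that kills `G₁` and `G₋₁` kills every element of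
non-zero degree. -/
theorem map_component_eq_zero {X : LocalLieAlgebra G₀ G₁ Gm} {L : Type*} [LieRing L]
    [LieAlgebra ℂ L] [IsLieAbelian L] (f : X.Maximal →ₗ⁅ℂ⁆ L) (hpos : ∀ x, f (X.pos x) = 0)
    (hneg : ∀ y, f (X.neg y) = 0) {i : ℤ} (hi : i ≠ 0) {u : X.Maximal}
    (hu : u ∈ X.component i) : f u = 0 := by
  have h : X.component i ≤ LinearMap.ker (f : X.Maximal →ₗ[ℂ] L) := by
    refine Submodule.span_le.2 fun u (hu : X.IsMonomial i u) => ?_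
    change f u = 0
    cases hu with
    | pos x => exact hpos x
    | zero a => exact absurd rfl hi
    | neg y => exact hneg y
    | lie _ _ => rw [LieHom.map_lie, trivial_lie_zero]
  exact h hu

/-- Let `X` be the sum of a local Lie algebra `Y`, with projection `p` and section `s`, and of an
abelian Lie algebra in degree `0`, with projection `κ`. The kernel of the homomorphism to the sum
of that abelian Lie algebra and of `Minimal Y` is the transitive ideal: it is transitive as the
minimal ideal of `Y` is, and by induction on the degree every transitive ideal contains the image
under `s` of the minimal ideal of `Y`. -/
theorem IsEuler.transitiveIdeal_eq {X : LocalLieAlgebra G₀ G₁ Gm} {Y : LocalLieAlgebra H₀ H₁ Hm}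
    {E : H₀} (hE : Y.IsEuler E) {L : Type*} [LieRing L] [LieAlgebra ℂ L] [IsLieAbelian L]
    (p : X.Maximal →ₗ⁅ℂ⁆ Y.Maximal) (s : Y.Maximal →ₗ⁅ℂ⁆ X.Maximal) (κ : X.Maximal →ₗ⁅ℂ⁆ L)
    (f₁ : G₁ ≃ H₁) (f₀ : G₀ → H₀) (fm : Gm ≃ Hm) (g₀ : H₀ → G₀)
    (p_pos : ∀ x, p (X.pos x) = Y.pos (f₁ x)) (p_zero : ∀ a, p (X.zero a) = Y.zero (f₀ a))
    (p_neg : ∀ y, p (X.neg y) = Y.neg (fm y)) (s_pos : ∀ x, s (Y.pos x) = X.pos (f₁.symm x))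
    (s_zero : ∀ a, s (Y.zero a) = X.zero (g₀ a)) (s_neg : ∀ y, s (Y.neg y) = X.neg (fm.symm y))
    (κ_pos : ∀ x, κ (X.pos x) = 0) (κ_neg : ∀ y, κ (X.neg y) = 0)
    (hs : ∀ u, κ u = 0 → s (p u) = u) (u : X.Maximal) :
    u ∈ X.transitiveIdeal ↔ κ u = 0 ∧ p u ∈ Y.minimalIdeal := by
  have hN := hE.isTransitiveIdeal_minimalIdeal
  have hp {i : ℤ} {u : X.Maximal} : u ∈ X.component i → p u ∈ Y.component i :=
    map_mem_component p (fun x => ⟨_, p_pos x⟩) (fun a => ⟨_, p_zero a⟩) fun y => ⟨_, p_neg y⟩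
  have hs' {i : ℤ} {u : Y.Maximal} : u ∈ Y.component i → s u ∈ X.component i :=
    map_mem_component s (fun x => ⟨_, s_pos x⟩) (fun a => ⟨_, s_zero a⟩) fun y => ⟨_, s_neg y⟩
  constructor
  · let K : LieIdeal ℂ X.Maximal := κ.ker ⊓ Y.minimalIdeal.comap p
    have hK (u : X.Maximal) : u ∈ K ↔ κ u = 0 ∧ p u ∈ Y.minimalIdeal := by
      rw [LieSubmodule.mem_inf, LieHom.mem_ker, LieIdeal.mem_comap]
    have hKt : X.IsTransitiveIdeal K := by
      constructor
      · intro i hi u hu h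
        refine (hK u).2 ⟨map_component_eq_zero κ κ_pos κ_neg (by omega) hu,
          hN.1 i hi _ (hp hu) fun y => ?_⟩
        have := ((hK _).1 (h (fm.symm y))).2
        rwa [LieHom.map_lie, p_neg, Equiv.apply_symm_apply] at this
      · intro i hi u hu h
        refine (hK u).2 ⟨map_component_eq_zero κ κ_pos κ_neg (by omega) hu,
          hN.2 i hi _ (hp hu) fun x => ?_⟩
        have := ((hK _).1 (h (f₁.symm x))).2
        rwa [LieHom.map_lie, p_pos, Equiv.apply_symm_apply] at this
    exact fun hu => (hK u).1 ((sInf_le hKt : X.transitiveIdeal ≤ K) hu)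
  · rintro ⟨hκ, hu⟩
    rw [← hs u hκ, ← LieSubmodule.mem_toSubmodule, transitiveIdeal,
      LieSubmodule.sInf_toSubmodule_eq_iInf]
    simp only [Submodule.mem_iInf]
    intro I hI
    have hzero {i : ℤ} (hi : i = -1 ∨ i = 0 ∨ i = 1) {w : Y.Maximal} (hw : w ∈ Y.minimalIdeal)
        (hwi : w ∈ Y.component i) : w = 0 := by
      refine Submodule.disjoint_def.1 hE.disjoint_minimalIdeal w hw ?_
      rcases hi with rfl | rfl | rfl
      · exact Submodule.mem_sup_left (Submodule.mem_sup_left hwi)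
      · exact Submodule.mem_sup_left (Submodule.mem_sup_right hwi)
      · exact Submodule.mem_sup_right hwi
    -- induction on the degree: the bracket of an element of degree `k + 2` with `G₋₁` has degree
    -- `k + 1`
    have hup (k : ℕ) : ∀ w ∈ Y.minimalIdeal, w ∈ Y.component (k + 1) → s w ∈ I := by
      induction k with
      | zero =>
        intro w hw hwk
        rw [hzero (by simp) hw hwk, map_zero]
        exact I.zero_mem
      | succ k ih =>
        intro w hw hwk
        refine hI.1 _ (by push_cast; omega) _ (hs' hwk) fun y => ?_
        have h := ih ⁅w, Y.neg (fm y)⁆ (lie_mem_left ℂ _ _ _ _ hw) (by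
          have := Y.lie_mem_component hwk (Y.neg_mem_component (fm y))
          convert this using 1
          push_cast
          ring_nf)
        rwa [LieHom.map_lie, s_neg, Equiv.symm_apply_apply] at h
    have hdown (k : ℕ) : ∀ w ∈ Y.minimalIdeal, w ∈ Y.component (-(k + 1)) → s w ∈ I := by
      induction k with
      | zero =>
        intro w hw hwk
        rw [hzero (by simp) hw hwk, map_zero]
        exact I.zero_mem
      | succ k ih =>
        intro w hw hwk
        refine hI.2 _ (by push_cast; omega) _ (hs' hwk) fun x => ?_
        have h := ih ⁅w, Y.pos (f₁ x)⁆ (lie_mem_left ℂ _ _ _ _ hw) (by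
          have := Y.lie_mem_component hwk (Y.pos_mem_component (f₁ x))
          convert this using 1
          push_cast
          ring_nf)
        rwa [LieHom.map_lie, s_pos, Equiv.symm_apply_apply] at h
    have hle : Y.minimalIdeal.toSubmodule ≤
        I.toSubmodule.comap (s : Y.Maximal →ₗ[ℂ] X.Maximal) := by
      refine Y.minimalIdeal_far.trans (iSup₂_le fun i (hi : 2 ≤ |i|) w hw => ?_)
      rcases le_abs'.1 hi with hi | hi
      · obtain ⟨k, rfl⟩ : ∃ k : ℕ, i = -(k + 1) := ⟨(-i - 1).toNat, by omega⟩
        exact hdown k w hw.1 hw.2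
      · obtain ⟨k, rfl⟩ : ∃ k : ℕ, i = k + 1 := ⟨(i - 1).toNat, by omega⟩
        exact hup k w hw.1 hw.2
    exact hle hu

end

end LocalLieAlgebra

/-! ### The center of a contragredient Lie algebra -/

section Contragredient

variable {n : ℕ} {C : Matrix (Fin n) (Fin n) ℂ}

theorem contragredientLocalPart_bracket_apply (x : WeightModule C) (y : WeightModule (-C))
    (i : Fin n) : (contragredientLocalPart C).bracket x y i = x i * y i := rfl

/-- If `C` is invertible, then some combination of the `h_i` acts on each `e_j` by `1`. -/
theorem exists_isEuler_contragredientLocalPart (hC : IsUnit C) :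
    ∃ E, (contragredientLocalPart C).IsEuler E := by
  have hdet := (Matrix.isUnit_iff_isUnit_det C).1 hC
  let E : Torus n := (1 : Fin n → ℂ) ᵥ* C⁻¹
  have hE (j : Fin n) : ∑ i, E i * C i j = 1 := by
    have h : ((1 : Fin n → ℂ) ᵥ* C⁻¹) ᵥ* C = 1 := by
      rw [Matrix.vecMul_vecMul, Matrix.nonsing_inv_mul _ hdet, Matrix.vecMul_one]
    exact congrFun h j
  refine ⟨E, fun a => rfl, fun x => funext fun j => ?_, fun y => funext fun j => ?_⟩
  · rw [WeightModule.lie_apply, hE, one_mul]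
  · rw [WeightModule.lie_apply]
    simp only [Matrix.neg_apply, mul_neg, Finset.sum_neg_distrib, hE, neg_mul, one_mul]
    rfl

/-- The elements `a` of degree `0` which kill `G₁` contain the kernel of the map from `ℂⁿ` to the
maximal graded Lie algebra, and they are mapped into that kernel by the injective map `ᵗC`, since
`ᵗC a = [a ∑ e_j, ∑ f_j]`. So both spaces have the same dimension and agree. This
argument does not need that the local part embeds into the maximal graded Lie algebra. -/
theorem contragredientLocalPart_zero_eq_zero (hC : IsUnit C) {a : Torus n}
    (ha : ∀ x, (contragredientLocalPart C).pos ⁅a, x⁆ = 0) :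
    (contragredientLocalPart C).zero a = 0 := by
  set Y := contragredientLocalPart C
  let K : Submodule ℂ (Torus n) := LinearMap.ker Y.zeroLinear
  let K' : Submodule ℂ (Torus n) :=
    { carrier := {a | ∀ x : WeightModule C, Y.posLinear ⁅a, x⁆ = 0}
      add_mem' := fun {a b} ha hb x => by rw [add_lie, map_add, ha, hb, add_zero]
      zero_mem' := fun x => by rw [zero_lie, map_zero]
      smul_mem' := fun c a ha x => by rw [smul_lie, map_smul, ha, smul_zero] }
  let T : Torus n →ₗ[ℂ] Torus n := C.vecMulLinear
  have hT : Function.Injective T := Matrix.vecMul_injective_of_isUnit hC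
  have hKK' : K ≤ K' := fun b hb x => by
    have hb : Y.zero b = 0 := hb
    rw [LocalLieAlgebra.posLinear_apply, ← Y.lie_zero_pos, hb, zero_lie]
  have hTK : K'.map T ≤ K := by
    rintro _ ⟨b, hb, rfl⟩
    let x : WeightModule C := (1 : Fin n → ℂ)
    let y : WeightModule (-C) := (1 : Fin n → ℂ)
    have hbr : Y.bracket ⁅b, x⁆ y = T b := by
      funext j
      rw [contragredientLocalPart_bracket_apply, WeightModule.lie_apply]
      exact (mul_one _).trans (mul_one _)
    change Y.zero (T b) = 0
    rw [← hbr, ← Y.lie_pos_neg, ← LocalLieAlgebra.posLinear_apply, hb x, zero_lie]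
  have hdim : Module.finrank ℂ K' ≤ Module.finrank ℂ K := by
    rw [(Submodule.equivMapOfInjective T hT K').finrank_eq]
    exact Submodule.finrank_mono hTK
  have heq : K = K' := Submodule.eq_of_le_of_finrank_le hKK' hdim
  have : a ∈ K := heq ▸ ha
  exact this

theorem center_contragredientLieAlgebra (hC : IsUnit C) {z : ContragredientLieAlgebra C}
    (hz : z ∈ LieAlgebra.center ℂ (ContragredientLieAlgebra C)) : z = 0 := by
  obtain ⟨E, hE⟩ := exists_isEuler_contragredientLocalPart hC
  obtain ⟨a, rfl, ha⟩ := hE.exists_of_mem_center hz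
  rw [contragredientLocalPart_zero_eq_zero hC ha]
  rfl

end Contragredient

/-! ### Regular pentads of Cartan type -/

namespace CartanPentad

variable {r n : ℕ} (P : CartanPentad r n)

theorem localPart_bracket : (P.pentad.localPart P.isStandard).bracket = P.cartanPhi :=
  (P.pentad.isPhiMap_phi P.isStandard).unique P.isPhiMap_cartanPhi

/-- The embedding `ᵗA D Γ` of `ℂⁿ` into `𝔥ʳ`, which sends `h_i` to `[e_i, f_i]`. -/
def coroot : Torus n →ₗ[ℂ] Torus r := (P.Aᵀ * P.D * P.Γ).mulVecLin

/-- The weights of `c ∈ 𝔥ʳ` on `ℂ_D`, divided by the Cartan matrix: the element of `ℂⁿ` that acts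
on the contragredient side like `c`. -/
def cocoroot : Torus r →ₗ[ℂ] Torus n := (P.D * P.cartanMatrix⁻¹).vecMulLinear

theorem coroot_eq_cartanPhi (v : WeightModule P.D) (φ : WeightModule (-P.D)) :
    P.coroot (fun j => v j * φ j : Fin n → ℂ) = P.cartanPhi v φ := by
  rw [cartanPhi_eq]
  change (P.Aᵀ * P.D * P.Γ) *ᵥ _ = _
  rw [← Matrix.mulVec_mulVec, ← Matrix.mulVec_mulVec]
  congr 2
  conv_lhs => rw [← P.isDiag_Γ.diagonal_diag]
  funext j
  rw [Matrix.mulVec_diagonal, Matrix.diag_apply]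

theorem weight_coroot (b : Torus n) (j : Fin n) :
    ∑ i, P.coroot b i * P.D i j = ∑ i, b i * P.cartanMatrix i j := by
  have h (b : Fin n → ℂ) : ((P.Aᵀ * P.D * P.Γ) *ᵥ b) ᵥ* P.D = b ᵥ* P.cartanMatrix := by
    have hΓ : P.Γᵀ = P.Γ := P.isDiag_Γ.isSymm
    rw [← Matrix.vecMul_transpose, Matrix.vecMul_vecMul, cartanMatrix]
    simp only [Matrix.transpose_mul, Matrix.transpose_transpose, hΓ, Matrix.mul_assoc]
  exact congrFun (h b) j

variable {P}

theorem IsRegular.weight_cocoroot (hP : P.IsRegular) (c : Torus r) (j : Fin n) :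
    ∑ i, P.cocoroot c i * P.cartanMatrix i j = ∑ i, c i * P.D i j := by
  have hdet := (Matrix.isUnit_iff_isUnit_det _).1 hP
  have h (c : Fin r → ℂ) : (c ᵥ* (P.D * P.cartanMatrix⁻¹)) ᵥ* P.cartanMatrix = c ᵥ* P.D := by
    rw [Matrix.vecMul_vecMul, Matrix.mul_assoc, Matrix.nonsing_inv_mul _ hdet, Matrix.mul_one]
  exact congrFun (h c) j

theorem IsRegular.cocoroot_coroot (hP : P.IsRegular) (b : Torus n) :
    P.cocoroot (P.coroot b) = b := by
  refine Matrix.vecMul_injective_of_isUnit hP (funext fun j => ?_)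
  exact (hP.weight_cocoroot _ j).trans (P.weight_coroot b j)

variable (P) in
/-- The identification of the `𝔥ʳ`-module `ℂ_D` with the degree `1` part of `Ĝ(C)`. -/
def posEquiv : WeightModule P.D ≃ₗ[ℂ] WeightModule P.cartanMatrix :=
  LinearEquiv.refl ℂ (Fin n → ℂ)

variable (P) in
/-- The identification of the `𝔥ʳ`-module `ℂ_{-D}` with the degree `-1` part of `Ĝ(C)`. -/
def negEquiv : WeightModule (-P.D) ≃ₗ[ℂ] WeightModule (-P.cartanMatrix) :=
  LinearEquiv.refl ℂ (Fin n → ℂ)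

/-- Elements of `𝔥ʳ` and of `ℂⁿ` with the same weights act in the same way in degree `1`. -/
theorem posEquiv_lie {c : Torus r} {b : Torus n}
    (h : ∀ j, ∑ i, b i * P.cartanMatrix i j = ∑ i, c i * P.D i j) (x : WeightModule P.D) :
    P.posEquiv ⁅c, x⁆ = ⁅b, P.posEquiv x⁆ := by
  funext j
  exact congrArg (· * x j) (h j).symm

/-- Elements of `𝔥ʳ` and of `ℂⁿ` with the same weights act in the same way in degree `-1`. -/
theorem negEquiv_lie {c : Torus r} {b : Torus n}
    (h : ∀ j, ∑ i, b i * P.cartanMatrix i j = ∑ i, c i * P.D i j) (y : WeightModule (-P.D)) :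
    P.negEquiv ⁅c, y⁆ = ⁅b, P.negEquiv y⁆ := by
  funext j
  refine congrArg (· * y j) ?_
  simp only [Matrix.neg_apply, mul_neg, Finset.sum_neg_distrib, h j]

/-- The image of `ᵗA D Γ` has codimension `r - n` in `𝔥ʳ`. -/
theorem IsRegular.exists_coordinates (hP : P.IsRegular) :
    ∃ k : Torus r →ₗ[ℂ] Torus (r - n), Function.Surjective k ∧
      LinearMap.ker k = LinearMap.range P.coroot := by
  have hinj : Function.Injective P.coroot := Function.LeftInverse.injective hP.cocoroot_coroot
  have hdim : Module.finrank ℂ (Torus r ⧸ LinearMap.range P.coroot) =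
      Module.finrank ℂ (Torus (r - n)) := by
    rw [Submodule.finrank_quotient, LinearMap.finrank_range_of_inj hinj, finrank_torus,
      finrank_torus, finrank_torus]
  let e := LinearEquiv.ofFinrankEq _ _ hdim
  refine ⟨e.toLinearMap ∘ₗ (LinearMap.range P.coroot).mkQ,
    e.surjective.comp (Submodule.mkQ_surjective _), ?_⟩
  rw [LinearEquiv.ker_comp, Submodule.ker_mkQ]

/-- The splitting of `𝔥ʳ` as the sum of `ℂⁿ`, embedded by `ᵗA D Γ`, and of the common kernel of the
weights gives a homomorphism from the maximal graded Lie algebra to the sum of `𝔤𝔩₁ʳ⁻ⁿ` and of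
`G(C)`. Its kernel is the transitive ideal. -/
theorem IsRegular.nonempty_lieEquiv (hP : P.IsRegular) :
    Nonempty (P.PCLieAlgebra ≃ₗ⁅ℂ⁆ Torus (r - n) × ContragredientLieAlgebra P.cartanMatrix) := by
  set X := P.pentad.localPart P.isStandard with hX
  set Y := contragredientLocalPart P.cartanMatrix
  obtain ⟨E, hE⟩ := exists_isEuler_contragredientLocalPart hP
  have hbr (x : WeightModule P.D) (y : WeightModule (-P.D)) :
      X.bracket x y = P.coroot (Y.bracket (P.posEquiv x) (P.negEquiv y)) := by
    rw [hX, localPart_bracket]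
    exact (P.coroot_eq_cartanPhi x y).symm
  obtain ⟨p, p_pos, p_zero, p_neg⟩ := X.exists_lift (Y.posLinear ∘ₗ P.posEquiv.toLinearMap)
    (Y.zeroLinear ∘ₗ P.cocoroot) (Y.negLinear ∘ₗ P.negEquiv.toLinearMap)
    (fun a b => (congrArg Y.zero (map_zero P.cocoroot)).trans (Y.lie_zero_zero _ _).symm)
    (fun a x => by
      simp only [LinearMap.comp_apply, LocalLieAlgebra.zeroLinear_apply,
        LocalLieAlgebra.posLinear_apply, Y.lie_zero_pos, LinearEquiv.coe_coe,
        posEquiv_lie (hP.weight_cocoroot a)])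
    (fun a y => by
      simp only [LinearMap.comp_apply, LocalLieAlgebra.zeroLinear_apply,
        LocalLieAlgebra.negLinear_apply, Y.lie_zero_neg, LinearEquiv.coe_coe,
        negEquiv_lie (hP.weight_cocoroot a)])
    (fun x y => by
      simp only [LinearMap.comp_apply, LocalLieAlgebra.zeroLinear_apply,
        LocalLieAlgebra.negLinear_apply, LocalLieAlgebra.posLinear_apply, Y.lie_pos_neg,
        LinearEquiv.coe_coe, hbr, hP.cocoroot_coroot])
  obtain ⟨s, s_pos, s_zero, s_neg⟩ := Y.exists_lift (X.posLinear ∘ₗ P.posEquiv.symm.toLinearMap)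
    (X.zeroLinear ∘ₗ P.coroot) (X.negLinear ∘ₗ P.negEquiv.symm.toLinearMap)
    (fun a b => (congrArg X.zero (map_zero P.coroot)).trans (X.lie_zero_zero _ _).symm)
    (fun b x => by
      simp only [LinearMap.comp_apply, LocalLieAlgebra.zeroLinear_apply,
        LocalLieAlgebra.posLinear_apply, X.lie_zero_pos, LinearEquiv.coe_coe]
      refine congrArg X.pos ((LinearEquiv.symm_apply_eq _).2 ?_)
      rw [posEquiv_lie (fun j => (P.weight_coroot b j).symm), LinearEquiv.apply_symm_apply])
    (fun b y => by
      simp only [LinearMap.comp_apply, LocalLieAlgebra.zeroLinear_apply,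
        LocalLieAlgebra.negLinear_apply, X.lie_zero_neg, LinearEquiv.coe_coe]
      refine congrArg X.neg ((LinearEquiv.symm_apply_eq _).2 ?_)
      rw [negEquiv_lie (fun j => (P.weight_coroot b j).symm), LinearEquiv.apply_symm_apply])
    (fun x y => by
      simp only [LinearMap.comp_apply, LocalLieAlgebra.zeroLinear_apply,
        LocalLieAlgebra.negLinear_apply, LocalLieAlgebra.posLinear_apply, X.lie_pos_neg,
        LinearEquiv.coe_coe, hbr, LinearEquiv.apply_symm_apply])
  obtain ⟨k, hk, hker⟩ := hP.exists_coordinates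
  obtain ⟨κ, κ_pos, κ_zero, κ_neg⟩ := X.exists_lift (0 : WeightModule P.D →ₗ[ℂ] Torus (r - n)) k 0
    (fun a b => by rw [Torus.lie_eq_zero, Torus.lie_eq_zero, map_zero])
    (fun a x => (lie_zero _).symm) (fun a y => (lie_zero _).symm)
    (fun x y => by
      rw [hbr, LinearMap.zero_apply, zero_lie]
      exact LinearMap.mem_ker.1 (hker ▸ LinearMap.mem_range_self _ _))
  have hk_coroot (b : Torus n) : k (P.coroot b) = 0 :=
    LinearMap.mem_ker.1 (hker ▸ LinearMap.mem_range_self _ _)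
  simp only [LinearMap.comp_apply, LocalLieAlgebra.zeroLinear_apply,
    LocalLieAlgebra.posLinear_apply, LocalLieAlgebra.negLinear_apply, LinearEquiv.coe_coe,
    LinearMap.zero_apply] at p_pos p_zero p_neg s_pos s_zero s_neg κ_pos κ_neg
  have hps (w : Y.Maximal) : p (s w) = w := by
    induction w using Y.maximal_induction with
    | pos x => rw [s_pos, p_pos, LinearEquiv.apply_symm_apply]
    | zero b => rw [s_zero, p_zero, hP.cocoroot_coroot]
    | neg y => rw [s_neg, p_neg, LinearEquiv.apply_symm_apply]
    | add u v hu hv => rw [map_add, map_add, hu, hv]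
    | smul c u hu => rw [map_smul, map_smul, hu]
    | lie u v hu hv => rw [LieHom.map_lie, LieHom.map_lie, hu, hv]
  have hκs (w : Y.Maximal) : κ (s w) = 0 := by
    induction w using Y.maximal_induction with
    | pos x => rw [s_pos, κ_pos]
    | zero b => rw [s_zero, κ_zero, hk_coroot]
    | neg y => rw [s_neg, κ_neg]
    | add u v hu hv => rw [map_add, map_add, hu, hv, add_zero]
    | smul c u hu => rw [map_smul, map_smul, hu, smul_zero]
    | lie u v hu hv => rw [LieHom.map_lie, LieHom.map_lie, hu, zero_lie]
  -- the common kernel of the weights is central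
  have hcentral (c : Torus r) (hc : P.cocoroot c = 0) (u : X.Maximal) : ⁅X.zero c, u⁆ = 0 := by
    have hweight : ∀ j, ∑ i, (0 : Torus n) i * P.cartanMatrix i j = ∑ i, c i * P.D i j :=
      hc ▸ hP.weight_cocoroot c
    induction u using X.maximal_induction with
    | pos x =>
      have : ⁅c, x⁆ = 0 := P.posEquiv.injective <| by
        rw [posEquiv_lie hweight, zero_lie, map_zero]
      rw [X.lie_zero_pos, this]
      exact X.posLinear.map_zero
    | zero a => exact (X.lie_zero_zero c a).trans X.zeroLinear.map_zero
    | neg y =>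
      have : ⁅c, y⁆ = 0 := P.negEquiv.injective <| by
        rw [negEquiv_lie hweight, zero_lie, map_zero]
      rw [X.lie_zero_neg, this]
      exact X.negLinear.map_zero
    | add u v hu hv => rw [lie_add, hu, hv, add_zero]
    | smul c u hu => rw [lie_smul, hu, smul_zero]
    | lie u v hu hv => rw [leibniz_lie, hu, hv, zero_lie, lie_zero, add_zero]
  have hsplit (u : X.Maximal) : ∃ c, P.cocoroot c = 0 ∧ u = X.zeroLinear c + s (p u) := by
    induction u using X.maximal_induction with
    | pos x =>
      exact ⟨0, map_zero _, by rw [p_pos, s_pos, LinearEquiv.symm_apply_apply, map_zero, zero_add]⟩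
    | zero a =>
      refine ⟨a - P.coroot (P.cocoroot a), ?_, ?_⟩
      · rw [map_sub, hP.cocoroot_coroot, sub_self]
      · rw [p_zero, s_zero, map_sub, LocalLieAlgebra.zeroLinear_apply,
          LocalLieAlgebra.zeroLinear_apply, sub_add_cancel]
    | neg y =>
      exact ⟨0, map_zero _, by rw [p_neg, s_neg, LinearEquiv.symm_apply_apply, map_zero, zero_add]⟩
    | add u v hu hv =>
      obtain ⟨c, hc, hu⟩ := hu
      obtain ⟨d, hd, hv⟩ := hv
      refine ⟨c + d, by rw [map_add, hc, hd, add_zero], ?_⟩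
      rw [map_add, map_add, map_add, add_add_add_comm, ← hu, ← hv]
    | smul t u hu =>
      obtain ⟨c, hc, hu⟩ := hu
      refine ⟨t • c, by rw [map_smul, hc, smul_zero], ?_⟩
      rw [map_smul, map_smul, map_smul, ← smul_add, ← hu]
    | lie u v hu hv =>
      obtain ⟨c, hc, hu⟩ := hu
      obtain ⟨d, hd, hv⟩ := hv
      refine ⟨0, map_zero _, ?_⟩
      rw [map_zero, zero_add, LieHom.map_lie, LieHom.map_lie]
      conv_lhs => rw [hu, hv]
      rw [LocalLieAlgebra.zeroLinear_apply, LocalLieAlgebra.zeroLinear_apply, add_lie,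
        hcentral c hc, zero_add, lie_add, ← lie_skew, hcentral d hd, neg_zero, zero_add]
  have hs (u : X.Maximal) (hu : κ u = 0) : s (p u) = u := by
    obtain ⟨c, hc, h⟩ := hsplit u
    have hkc : k c = 0 := by
      rw [h, map_add, hκs, add_zero, LocalLieAlgebra.zeroLinear_apply, κ_zero] at hu
      exact hu
    obtain ⟨b, rfl⟩ : c ∈ LinearMap.range P.coroot := hker ▸ LinearMap.mem_ker.2 hkc
    rw [hP.cocoroot_coroot] at hc
    rw [hc, map_zero, map_zero, zero_add] at h
    exact h.symm
  have hT := hE.transitiveIdeal_eq p s κ P.posEquiv.toEquiv P.cocoroot P.negEquiv.toEquiv P.coroot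
    p_pos p_zero p_neg s_pos s_zero s_neg κ_pos κ_neg hs
  let q : Y.Maximal →ₗ⁅ℂ⁆ Y.Minimal :=
    { Y.minimalIdeal.toSubmodule.mkQ with map_lie' := fun {_ _} => rfl }
  have hq (w : Y.Maximal) : q w = 0 ↔ w ∈ Y.minimalIdeal := Submodule.Quotient.mk_eq_zero _
  refine exists_lieEquiv_of_ker_eq (κ.prod (q.comp p)) ?_ X.transitiveIdeal ?_
  · rintro ⟨t, g⟩
    obtain ⟨w, rfl⟩ : ∃ w, q w = g := Submodule.mkQ_surjective _ g
    obtain ⟨c, rfl⟩ := hk t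
    refine ⟨X.zero (c - P.coroot (P.cocoroot c)) + s w, Prod.ext ?_ ?_⟩
    · change κ _ = _
      rw [map_add, hκs, κ_zero, map_sub, hk_coroot, sub_zero, add_zero]
    · change q (p _) = _
      rw [map_add, hps, p_zero, map_sub, hP.cocoroot_coroot, sub_self,
        ← LocalLieAlgebra.zeroLinear_apply, map_zero, zero_add]
  · ext u
    rw [LieHom.mem_ker, hT, ← hq]
    exact Prod.mk_eq_zero

end CartanPentad

end

theorem mainTheorem1 (r n : ℕ) (hn : 1 ≤ n) (hnr : n ≤ r)
    (P : CartanPentad r n) (hP : P.IsRegular) :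
    (∃ e : P.PCLieAlgebra ≃ₗ⁅ℂ⁆ Torus (r - n) × ContragredientLieAlgebra P.cartanMatrix,
      ∀ x : P.PCLieAlgebra,
        x ∈ LieAlgebra.center ℂ P.PCLieAlgebra ↔ (e x).2 = 0) ∧
    (r = n → Nonempty (P.PCLieAlgebra ≃ₗ⁅ℂ⁆ ContragredientLieAlgebra P.cartanMatrix)) := by
  obtain ⟨e⟩ := hP.nonempty_lieEquiv
  refine ⟨⟨e, fun x => ⟨fun hx => ?_, fun hx y => ?_⟩⟩, ?_⟩
  · refine center_contragredientLieAlgebra hP fun g => ?_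
    obtain ⟨y, hy⟩ := e.surjective (0, g)
    have h : ⁅y, x⁆ = 0 := hx y
    have h' : ⁅e y, e x⁆ = 0 :=
      (e.map_lie y x).symm.trans ((congrArg e h).trans (map_zero e.toLieHom))
    rw [show e y = (0, g) from hy] at h'
    exact congrArg Prod.snd h'
  · refine e.injective ?_
    change e.toLieHom ⁅y, x⁆ = e.toLieHom 0
    have hx : (e.toLieHom x).2 = 0 := hx
    rw [LieHom.map_lie, map_zero, LieAlgebra.Prod.bracket_apply, hx, lie_zero, trivial_lie_zero]
    rfl
  · rintro rfl
    have : Subsingleton (Torus (r - r)) := by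
      rw [Nat.sub_self]
      exact inferInstanceAs (Subsingleton (Fin 0 → ℂ))
    refine ⟨e.trans (LieEquiv.ofBijective (LieHom.snd ℂ _ _) ⟨?_, LieHom.snd_surjective⟩)⟩
    exact fun u v h => Prod.ext (Subsingleton.elim _ _) h
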